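/- Let $Q(\mathbf{X})=\mathbf{X}^T\mathbf{A}\mathbf{X}$ be a quadratic form in $n$ variables, where $\mathbf{A}$ is a symmetric $n\times n$ matrix with entries in $\mathbb{Z}$ and $\Delta_Q:=\det\mathbf{A}\neq 0$, and let $k\in\mathbb{Z}$. Say that $(k,Q)$ satisfies *weak LSC* if the congruence $Q(\mathbf{x})\equiv k \pmod{p^t}$ is soluble for every prime power $p^t$. Let $\tau_2=1$ and $\tau_p=0$ for primes $p>2$, and say that $(k,Q)$ satisfies *strong LSC* if for every prime $p$ there is $\mathbf{x}\in\mathbb{Z}^n$ with $Q(\mathbf{x})\equiv k\pmod{p^{1+2\tau_p}}$ such that not all coordinates of $\mathbf{A}\mathbf{x}$ are divisible by $p$. For each prime $p$ put $$\sigma_p(k,Q):=\lim_{t\to\infty}p^{-t(n-1)}\#\{\mathbf{x}\in(\mathbb{Z}/p^t\mathbb{Z})^n: Q(\mathbf{x})\equiv k \pmod{p^t}\},\qquad \mathfrak{S}(k,Q):=\prod_p\sigma_p(k,Q).$$ Let $\varepsilon>0$. (i) Suppose that $n\geq 5$ and that $(k,Q)$ satisfies weak LSC. Then the limits $\sigma_p(k,Q)$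 exist, the product $\mathfrak{S}(k,Q)$ converges, and $$\mathfrak{S}(k,Q)\geq c\,|\Delta_Q|^{-\theta_{k,Q}-\varepsilon},$$ where $\theta_{k,Q}=0$ if $(k,Q)$ satisfies strong LSC and $\theta_{k,Q}=1/(n-4)$ otherwise, and $c>0$ is a constant depending only on $n$ and $\varepsilon$. (ii) Suppose that $n=4$, that $k>0$ and that $(k,Q)$ satisfies strong LSC. Then the limits $\sigma_p(k,Q)$ exist, the product $\mathfrak{S}(k,Q)$ converges, and $$\mathfrak{S}(k,Q)\geq c\,k^{-\varepsilon}|\Delta_Q|^{-\varepsilon},$$ where $c>0$ is a constant depending only on $\varepsilon$. -/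

import Mathlib

open Filter Topology
open scoped Matrix

noncomputable section

namespace QuadRep

/-- The integral quadratic form `Q(x) = xᵀ A x` with underlying integer matrix `A`
(assumed symmetric in the theorem), evaluated at a vector with entries in a
commutative ring `R`. -/
def form {n : ℕ} (A : Matrix (Fin n) (Fin n) ℤ) {R : Type*} [CommRing R]
    (x : Fin n → R) : R :=
  x ⬝ᵥ (A.map (Int.cast : ℤ → R) *ᵥ x)

/-- Weak local solubility condition: `Q(x) ≡ k (mod p ^ t)` is soluble for every prime
power `p ^ t`. -/
def WeakLSC {n : ℕ} (k : ℤ) (A : Matrix (Fin n) (Fin n) ℤ) : Prop :=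
  ∀ p : ℕ, p.Prime → ∀ t : ℕ, ∃ x : Fin n → ℤ, form A x ≡ k [ZMOD (p : ℤ) ^ t]

/-- `τ_p`, equal to `1` for `p = 2` and to `0` for the other primes. -/
def tau (p : ℕ) : ℕ := if p = 2 then 1 else 0

/-- Strong local solubility condition: for every prime `p` there is `x` with
`Q(x) ≡ k (mod p ^ (1 + 2 τ_p))` and `p ∤ A x`, that is, some coordinate of the vector
`A x` is not divisible by `p`. -/
def StrongLSC {n : ℕ} (k : ℤ) (A : Matrix (Fin n) (Fin n) ℤ) : Prop :=
  ∀ p : ℕ, p.Prime → ∃ x : Fin n → ℤ,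
    form A x ≡ k [ZMOD (p : ℤ) ^ (1 + 2 * tau p)] ∧ ∃ i, ¬ ((p : ℤ) ∣ (A *ᵥ x) i)

/-- The number of `x` modulo `m` with `Q(x) ≡ k (mod m)`. -/
def solCount {n : ℕ} (k : ℤ) (A : Matrix (Fin n) (Fin n) ℤ) (m : ℕ) : ℕ :=
  Nat.card {x : Fin n → ZMod m // form A x = (k : ZMod m)}

/-- The sequence `p ^ (-t (n - 1)) * N(p ^ t)` whose limit is the `p`-adic density. -/
def densitySeq {n : ℕ} (k : ℤ) (A : Matrix (Fin n) (Fin n) ℤ) (p t : ℕ) : ℝ :=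
  (solCount k A (p ^ t) : ℝ) / (p : ℝ) ^ (t * (n - 1))

/-- The `p`-adic density `σ_p(k, Q)`. -/
def sigma {n : ℕ} (k : ℤ) (A : Matrix (Fin n) (Fin n) ℤ) (p : ℕ) : ℝ :=
  limUnder atTop (densitySeq k A p)

/-- The singular series `𝔖(k, Q) = ∏ σ_p`, the product being over all primes. -/
def singularSeries {n : ℕ} (k : ℤ) (A : Matrix (Fin n) (Fin n) ℤ) : ℝ :=
  ∏' p : Nat.Primes, sigma k A p

/-- The singular series is well defined: each limit defining a `p`-adic density exists,
and the product of the densities converges. -/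
def SingularSeriesConverges {n : ℕ} (k : ℤ) (A : Matrix (Fin n) (Fin n) ℤ) : Prop :=
  (∀ p : ℕ, p.Prime → Tendsto (densitySeq k A p) atTop (𝓝 (sigma k A p))) ∧
    Multipliable (fun p : Nat.Primes => sigma k A p)

open Classical in
/-- The exponent `θ_{k,Q}`. -/
def theta {n : ℕ} (k : ℤ) (A : Matrix (Fin n) (Fin n) ℤ) : ℝ :=
  if StrongLSC k A then 0 else 1 / ((n : ℝ) - 4)

end QuadRep

end

namespace QuadRep

variable {n : ℕ} {R S : Type*} [CommRing R] [CommRing S]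

/-! Write N(m) for the number of solutions modulo m. Detecting the congruence by additive
characters, the change from p^(n-1) N(p^t) to N(p^(t+1)) is a sum of quadratic Gauss sums at unit
frequencies. Squaring such a sum bounds it by the number of zeros of the gradient modulo p^(t+1),
which is bounded in t and equals 1 when p ∤ 2Δ. Successive terms of the density sequence thus differ
by O(p^(-(n-2)(t+1)/2)): the limits exist, and for n ≥ 5 and p ∤ 2Δ they are 1 + O(p^(-3/2)). For n
= 4 the step from t = 0 to t = 1 is only O(1/p); there a second moment over all residues modulo p,
with the invariance of the count under k ↦ k j², recovers p^(-3/2) when p ∤ k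
(`abs_sigma_sub_one_le_of_four`). This gives convergence of the product.

At the remaining primes a lower bound is needed. A solution at which Hensel's lemma applies forces
σ_p to exceed a constant depending only on n (`smoothBound_le_sigma`); strong LSC provides one at
each p. If there is only weak solubility and no such solution, then p ∣ k and the zeros of Q modulo
p form a subspace of codimension s ≤ 2. Restricting Q to the corresponding sublattice and dividing Q
and k by p (`exists_descent`) lowers the p-adic valuation of the determinant by n - 2s and costs a
factor p^(s-1) in the density. A factor p is lost only when s = 2, against a drop of n - 4, so the
total loss over all p is at most |2^n Δ|^(1/(n-4)).

Finally, constants at the primes dividing N cost c^ω(N), which is at least a constant multiple of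
N^(-ε). The matrices M are not assumed symmetric, since dividing by p = 2 in the descent may leave
odd cross terms; the Hessian M + Mᵀ replaces 2A throughout. -/

/-! ### Polarisation of an integral quadratic form. -/

/-- The gradient `(M + Mᵀ) x` of the quadratic form `xᵀ M x`. -/
def grad (M : Matrix (Fin n) (Fin n) ℤ) (x : Fin n → R) : Fin n → R :=
  (M + Mᵀ).map (Int.cast : ℤ → R) *ᵥ x

lemma map_form (f : R →+* S) (M : Matrix (Fin n) (Fin n) ℤ) (x : Fin n → R) :
    f (form M x) = form M (fun i => f (x i)) := by
  have h : (M.map (Int.cast : ℤ → R)).map f = M.map (Int.cast : ℤ → S) := by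
    ext i j; simp
  rw [form, RingHom.map_dotProduct, form]
  congr 1
  ext i
  rw [Function.comp_apply, RingHom.map_mulVec, h]
  rfl

lemma map_grad (f : R →+* S) (M : Matrix (Fin n) (Fin n) ℤ) (x : Fin n → R) (i : Fin n) :
    f (grad M x i) = grad M (fun i => f (x i)) i := by
  have h : ((M + Mᵀ).map (Int.cast : ℤ → R)).map f = (M + Mᵀ).map (Int.cast : ℤ → S) := by
    ext i j; simp
  rw [grad, RingHom.map_mulVec, h]
  rfl

lemma form_intCast (M : Matrix (Fin n) (Fin n) ℤ) (x : Fin n → ℤ) :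
    form M (fun i => (x i : R)) = ((form M x : ℤ) : R) :=
  (map_form (Int.castRingHom R) M x).symm

lemma grad_intCast (M : Matrix (Fin n) (Fin n) ℤ) (x : Fin n → ℤ) (i : Fin n) :
    grad M (fun i => (x i : R)) i = ((grad M x i : ℤ) : R) :=
  (map_grad (Int.castRingHom R) M x i).symm

lemma form_add (M : Matrix (Fin n) (Fin n) ℤ) (x y : Fin n → R) :
    form M (x + y) = form M x + form M y + y ⬝ᵥ grad M x := by
  have h1 : (M + Mᵀ).map (Int.cast : ℤ → R) = M.map (Int.cast : ℤ → R) + (M.map Int.cast)ᵀ := by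
    ext i j; simp
  simp only [form, grad, h1, Matrix.mulVec_add, Matrix.add_mulVec, add_dotProduct, dotProduct_add]
  rw [Matrix.mulVec_transpose, dotProduct_comm y (x ᵥ* _), ← Matrix.dotProduct_mulVec]
  ring

lemma form_smul (M : Matrix (Fin n) (Fin n) ℤ) (c : R) (x : Fin n → R) :
    form M (c • x) = c ^ 2 * form M x := by
  simp only [form, Matrix.mulVec_smul, dotProduct_smul, smul_dotProduct, smul_eq_mul]
  ring

lemma form_zero (M : Matrix (Fin n) (Fin n) ℤ) : form M (0 : Fin n → R) = 0 := by
  simp [form]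

lemma grad_add (M : Matrix (Fin n) (Fin n) ℤ) (x y : Fin n → R) :
    grad M (x + y) = grad M x + grad M y := by
  simp [grad, Matrix.mulVec_add]

lemma grad_smul (M : Matrix (Fin n) (Fin n) ℤ) (c : R) (x : Fin n → R) :
    grad M (c • x) = c • grad M x := by
  simp [grad, Matrix.mulVec_smul]

lemma dotProduct_grad_comm (M : Matrix (Fin n) (Fin n) ℤ) (x y : Fin n → R) :
    y ⬝ᵥ grad M x = x ⬝ᵥ grad M y := by
  have h := form_add M x y
  rw [add_comm, form_add] at h
  linear_combination -h

lemma dotProduct_grad_self (M : Matrix (Fin n) (Fin n) ℤ) (x : Fin n → R) :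
    x ⬝ᵥ grad M x = 2 * form M x := by
  have h := form_add M x x
  rw [← two_smul R x, form_smul] at h
  linear_combination -h

/-- Multiply by the adjugate of the Hessian; this works over any commutative ring, in particular
modulo prime powers. -/
lemma det_smul_eq_zero_of_grad_eq_zero (M : Matrix (Fin n) (Fin n) ℤ) {u : Fin n → R}
    (hu : grad M u = 0) (i : Fin n) : ((M + Mᵀ).det : R) * u i = 0 := by
  have h : ((M + Mᵀ).map (Int.cast : ℤ → R)).adjugate *ᵥ grad M u = 0 := by
    rw [hu, Matrix.mulVec_zero]
  rw [grad, Matrix.mulVec_mulVec, Matrix.adjugate_mul, Matrix.smul_mulVec, Matrix.one_mulVec] at h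
  have h2 := congrFun h i
  have h3 : ((M + Mᵀ).map (Int.cast : ℤ → R)).det = ((M + Mᵀ).det : R) :=
    ((Int.castRingHom R).map_det (M + Mᵀ)).symm
  rw [h3] at h2
  simpa using h2

/-! ### Counting modulo prime powers. -/

lemma solCount_eq_card (k : ℤ) (M : Matrix (Fin n) (Fin n) ℤ) (m : ℕ) [NeZero m] :
    solCount k M m = (Finset.univ.filter fun x : Fin n → ZMod m => form M x = (k : ZMod m)).card := by
  rw [solCount, Nat.card_eq_fintype_card, Fintype.card_subtype]

lemma card_filter_comp_mul_card {G H : Type*} [AddCommGroup G] [AddCommGroup H] [Fintype G]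
    [Fintype H] (f : G →+ H) (hf : Function.Surjective f) (P : H → Prop) [DecidablePred P] :
    (Finset.univ.filter fun g => P (f g)).card * Fintype.card H
      = Fintype.card G * (Finset.univ.filter P).card := by
  classical
  have hfib : ∀ h : H, (Finset.univ.filter fun g => f g = h).card
      = (Finset.univ.filter fun g => f g = 0).card := fun h =>
    AddMonoidHom.card_fiber_eq_of_mem_range f (hf h) (hf 0)
  have h1 : Fintype.card G = Fintype.card H * (Finset.univ.filter fun g => f g = 0).card := by
    rw [← Finset.card_univ (α := G),
      Finset.card_eq_sum_card_fiberwise (f := f) (t := Finset.univ) (by intro; simp),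
      Finset.sum_congr rfl fun h _ => hfib h]
    simp
  have h2 : (Finset.univ.filter fun g => P (f g)).card
      = (Finset.univ.filter P).card * (Finset.univ.filter fun g => f g = 0).card := by
    rw [Finset.card_eq_sum_card_fiberwise (f := f) (t := Finset.univ.filter P)
      (by intro x; simp), Finset.sum_congr rfl (g := fun _ => (Finset.univ.filter fun g => f g = 0).card)]
    · simp
    · intro h hh
      rw [← hfib h]
      congr 1
      ext g
      simp only [Finset.mem_filter, Finset.mem_univ, true_and] at hh ⊢
      constructor
      · exact fun h => h.2
      · rintro rfl; exact ⟨hh, rfl⟩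
  rw [h2, h1]; ring

/-- Coordinatewise reduction of vectors modulo a divisor of the modulus. -/
def reduction (n : ℕ) {a b : ℕ} (h : a ∣ b) : (Fin n → ZMod b) →+ (Fin n → ZMod a) where
  toFun x i := ZMod.castHom h (ZMod a) (x i)
  map_zero' := by ext; simp
  map_add' x y := by ext; exact map_add _ _ _

lemma reduction_surjective {a b : ℕ} (h : a ∣ b) : Function.Surjective (reduction n h) := by
  intro y
  choose x hx using fun i => ZMod.castHom_surjective h (y i)
  exact ⟨x, funext hx⟩

lemma form_reduction (M : Matrix (Fin n) (Fin n) ℤ) {a b : ℕ} (h : a ∣ b) (x : Fin n → ZMod b) :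
    form M (reduction n h x) = ZMod.castHom h (ZMod a) (form M x) :=
  (map_form (ZMod.castHom h (ZMod a)) M x).symm

lemma card_filter_reduction {p t : ℕ} [Fact p.Prime] (P : (Fin n → ZMod (p ^ t)) → Prop)
    [DecidablePred P] :
    (Finset.univ.filter fun x => P (reduction n (pow_dvd_pow p t.le_succ) x)).card
      = p ^ n * (Finset.univ.filter P).card := by
  have hp : 0 < p := (Fact.out : p.Prime).pos
  have h := card_filter_comp_mul_card _ (reduction_surjective (n := n) (pow_dvd_pow p t.le_succ)) P
  simp only [Fintype.card_pi, ZMod.card, Finset.prod_const, Finset.card_univ, Fintype.card_fin] at h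
  have h3 : (p ^ t.succ) ^ n = p ^ n * (p ^ t) ^ n := by rw [pow_succ, mul_pow, mul_comm]
  rw [h3] at h
  have h4 : 0 < (p ^ t) ^ n := by positivity
  apply Nat.eq_of_mul_eq_mul_right h4
  rw [h]; ring

lemma natCast_mul_eq_zero_iff_castHom {p t : ℕ} [Fact p.Prime] (y : ZMod (p ^ (t + 1))) :
    (p : ZMod (p ^ (t + 1))) * y = 0 ↔ ZMod.castHom (pow_dvd_pow p t.le_succ) (ZMod (p ^ t)) y = 0 := by
  obtain ⟨z, rfl⟩ := ZMod.intCast_surjective y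
  have hp : (p : ℤ) ≠ 0 := by exact_mod_cast (Fact.out : p.Prime).ne_zero
  rw [map_intCast, ZMod.intCast_zmod_eq_zero_iff_dvd, ← Int.cast_natCast (R := ZMod (p ^ (t+1))),
    ← Int.cast_mul, ZMod.intCast_zmod_eq_zero_iff_dvd]
  push_cast
  rw [pow_succ, mul_comm ((p : ℤ) ^ t), mul_dvd_mul_iff_left hp]

lemma card_natCast_mul_eq_zero {p t : ℕ} [Fact p.Prime] :
    (Finset.univ.filter fun y : ZMod (p ^ (t + 1)) => (p : ZMod (p ^ (t + 1))) * y = 0).card = p := by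
  classical
  have hp : 0 < p := (Fact.out : p.Prime).pos
  have h := card_filter_comp_mul_card
    (ZMod.castHom (pow_dvd_pow p t.le_succ) (ZMod (p ^ t))).toAddMonoidHom
    (ZMod.castHom_surjective (pow_dvd_pow p t.le_succ)) (fun y => y = 0)
  simp only [natCast_mul_eq_zero_iff_castHom]
  simp only [ZMod.card, Finset.filter_eq', Finset.mem_univ, if_true, Finset.card_singleton] at h
  have h4 : 0 < p ^ t := by positivity
  apply Nat.eq_of_mul_eq_mul_right h4
  refine Eq.trans h ?_
  rw [pow_succ]; ring

/-! ### Gauss sums and the increments of the density sequence. -/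

lemma sum_stdAddChar_dotProduct {m : ℕ} [NeZero m] (w : Fin n → ZMod m) :
    ∑ y : Fin n → ZMod m, ZMod.stdAddChar (y ⬝ᵥ w) = if w = 0 then (m : ℂ) ^ n else 0 := by
  classical
  let f : (Fin n → ZMod m) →+ ZMod m :=
    { toFun := fun y => y ⬝ᵥ w
      map_zero' := by simp
      map_add' := fun x y => add_dotProduct x y w }
  have h := AddChar.sum_eq_ite ((ZMod.stdAddChar (N := m)).compAddMonoidHom f)
  have h2 : (ZMod.stdAddChar (N := m)).compAddMonoidHom f = 0 ↔ w = 0 := by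
    constructor
    · intro h0
      by_contra hw
      obtain ⟨i, hi⟩ := Function.ne_iff.mp hw
      apply ZMod.isPrimitive_stdAddChar m hi
      ext a
      have := DFunLike.congr_fun h0 (Pi.single i a)
      simpa [f, mul_comm] using this
    · rintro rfl
      ext a
      simp [f]
  rw [if_congr h2 rfl rfl] at h
  simpa [f] using h

/-- Weyl differencing: with x = y + u the phase Q(y + u) - Q(y) is linear in y, with coefficient
vector the gradient at u, so the sum over y vanishes unless that gradient does. -/
lemma norm_sq_sum_stdAddChar_form_le (M : Matrix (Fin n) (Fin n) ℤ) {m : ℕ} [NeZero m]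
    {a : ZMod m} (ha : IsUnit a) :
    ‖∑ x : Fin n → ZMod m, ZMod.stdAddChar (a * form M x)‖ ^ 2
      ≤ (m : ℝ) ^ n * (Finset.univ.filter fun u : Fin n → ZMod m => grad M u = 0).card := by
  set ψ := ZMod.stdAddChar (N := m)
  have key : (∑ x : Fin n → ZMod m, ψ (a * form M x)) *
      (starRingEnd ℂ) (∑ x : Fin n → ZMod m, ψ (a * form M x))
      = ∑ u : Fin n → ZMod m, ψ (a * form M u) * (if grad M u = 0 then (m : ℂ) ^ n else 0) := by
    rw [map_sum, Finset.mul_sum]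
    have h1 : ∀ y : Fin n → ZMod m, (∑ x : Fin n → ZMod m, ψ (a * form M x)) *
        (starRingEnd ℂ) (ψ (a * form M y))
        = ∑ u : Fin n → ZMod m, ψ (a * form M u) * ψ (y ⬝ᵥ (a • grad M u)) := by
      intro y
      rw [Finset.sum_mul, ← Equiv.sum_comp (Equiv.addLeft y)]
      refine Finset.sum_congr rfl fun u _ => ?_
      rw [← AddChar.map_neg_eq_conj, ← AddChar.map_add_eq_mul, ← AddChar.map_add_eq_mul]
      congr 1
      rw [Equiv.coe_addLeft, form_add, dotProduct_smul, dotProduct_grad_comm M u y, smul_eq_mul]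
      ring
    rw [Finset.sum_congr rfl fun y _ => h1 y, Finset.sum_comm]
    refine Finset.sum_congr rfl fun u _ => ?_
    rw [← Finset.mul_sum, sum_stdAddChar_dotProduct]
    congr 1
    refine if_congr ?_ rfl rfl
    exact ha.smul_eq_zero
  have h2 : ((‖∑ x : Fin n → ZMod m, ψ (a * form M x)‖ ^ 2 : ℝ) : ℂ)
      = ∑ u : Fin n → ZMod m, ψ (a * form M u) * (if grad M u = 0 then (m : ℂ) ^ n else 0) := by
    rw [← key, Complex.mul_conj, Complex.normSq_eq_norm_sq]
  have h3 := congrArg norm h2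
  rw [Complex.norm_real, Real.norm_of_nonneg (by positivity)] at h3
  rw [h3]
  refine (norm_sum_le _ _).trans ?_
  rw [mul_comm, ← nsmul_eq_mul, ← Finset.sum_const, Finset.sum_filter]
  refine Finset.sum_le_sum fun u _ => ?_
  rw [norm_mul, AddChar.norm_apply, one_mul]
  split_ifs <;> simp

lemma sum_stdAddChar_mul {m : ℕ} [NeZero m] (y : ZMod m) :
    ∑ a : ZMod m, ZMod.stdAddChar (a * y) = if y = 0 then (m : ℂ) else 0 := by
  classical
  rw [AddChar.sum_mulShift y (ZMod.isPrimitive_stdAddChar m)]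
  split_ifs <;> simp [ZMod.card]

/-- The map a ↦ p a covers each non-unit exactly p times, so the combination on the left isolates
the unit frequencies. -/
lemma sum_comp_natCast_mul {p t : ℕ} [Fact p.Prime] (G : ZMod (p ^ (t + 1)) → ℂ) :
    (p : ℂ) * ∑ a, G a - ∑ a, G ((p : ZMod (p ^ (t + 1))) * a)
      = (p : ℂ) * ∑ a with IsUnit a, G a := by
  classical
  have hp : p.Prime := Fact.out
  rw [← Finset.sum_filter_add_sum_filter_not Finset.univ (fun a : ZMod (p ^ (t+1)) => IsUnit a) G]
  suffices h : ∑ a, G ((p : ZMod (p ^ (t + 1))) * a)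
      = (p : ℂ) * ∑ a with ¬ IsUnit a, G a by
    rw [h]; ring
  rw [Finset.sum_comp G (fun a => (p : ZMod (p ^ (t + 1))) * a), Finset.mul_sum]
  have himg : Finset.image (fun a => (p : ZMod (p ^ (t + 1))) * a) Finset.univ
      = Finset.univ.filter fun a => ¬ IsUnit a := by
    ext a
    simp only [Finset.mem_image, Finset.mem_univ, true_and, Finset.mem_filter]
    constructor
    · rintro ⟨b, rfl⟩ hu
      exact ZMod.prime_natCast_not_isUnit_pow hp t.succ_pos (isUnit_of_mul_isUnit_left hu)
    · intro ha
      obtain ⟨z, rfl⟩ := ZMod.natCast_zmod_surjective a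
      rw [ZMod.isUnit_natCast_iff_not_dvd_pow hp t.succ_pos, not_not] at ha
      obtain ⟨c, rfl⟩ := ha
      exact ⟨c, by push_cast; rfl⟩
  rw [himg]
  refine Finset.sum_congr rfl fun b hb => ?_
  rw [← himg, Finset.mem_image] at hb
  obtain ⟨c, -, hc⟩ := hb
  have := AddMonoidHom.card_fiber_eq_of_mem_range (AddMonoidHom.mulLeft (p : ZMod (p ^ (t + 1))))
    (x := b) (y := 0) ⟨c, hc⟩ ⟨0, by simp⟩
  have h2 : (Finset.univ.filter fun a => (p : ZMod (p ^ (t + 1))) * a = b).card = p :=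
    Eq.trans (by convert this <;> rfl) (card_natCast_mul_eq_zero (p := p) (t := t))
  rw [h2, nsmul_eq_mul]

lemma card_mul_pow_eq_sum (k : ℤ) (M : Matrix (Fin n) (Fin n) ℤ) {m : ℕ} [NeZero m] (c : ZMod m) :
    ((Finset.univ.filter fun x : Fin n → ZMod m => c * (form M x - (k : ZMod m)) = 0).card : ℂ) * m
      = ∑ a : ZMod m, ∑ x : Fin n → ZMod m, ZMod.stdAddChar (c * a * (form M x - (k : ZMod m))) := by
  rw [Finset.sum_comm]
  have : ∀ x : Fin n → ZMod m, ∑ a : ZMod m, ZMod.stdAddChar (c * a * (form M x - (k : ZMod m)))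
      = if c * (form M x - (k : ZMod m)) = 0 then (m : ℂ) else 0 := by
    intro x
    rw [← sum_stdAddChar_mul]
    refine Finset.sum_congr rfl fun a _ => ?_
    congr 1; ring
  rw [Finset.sum_congr rfl fun x _ => this x, ← Finset.sum_filter, Finset.sum_const, nsmul_eq_mul]

/-- The increment of the density sequence, bounded through quadratic Gauss sums. -/
lemma abs_solCount_sub_le (k : ℤ) (M : Matrix (Fin n) (Fin n) ℤ) {p t K : ℕ} [Fact p.Prime]
    (hn : 1 ≤ n)
    (hK : (Finset.univ.filter fun u : Fin n → ZMod (p ^ (t + 1)) => grad M u = 0).card ≤ K) :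
    |(solCount k M (p ^ (t + 1)) : ℝ) - p ^ (n - 1) * solCount k M (p ^ t)|
      ≤ √K * √((p : ℝ) ^ ((t + 1) * n)) := by
  have hp : p.Prime := Fact.out
  have hp0 : (0 : ℝ) < p := by exact_mod_cast hp.pos
  set m := p ^ (t + 1) with hm
  set ψ := ZMod.stdAddChar (N := m)
  set G : ZMod m → ℂ := fun a => ∑ x : Fin n → ZMod m, ψ (a * (form M x - (k : ZMod m))) with hG
  have e1 : (solCount k M m : ℂ) * m = ∑ a, G a := by
    have := card_mul_pow_eq_sum k M (1 : ZMod m)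
    simp only [one_mul, sub_eq_zero] at this
    rw [solCount_eq_card, this]
  -- Multiplying by p in ℤ/p^(t+1) only tests the congruence modulo p^t, and each vector modulo p^t
  -- has p^n lifts.
  have e2 : ((p : ℂ) ^ n * solCount k M (p ^ t)) * m = ∑ a, G ((p : ZMod m) * a) := by
    have h1 := card_mul_pow_eq_sum k M (p : ZMod m)
    have h2 := card_filter_reduction (n := n) (p := p) (t := t)
      (fun x => form M x = ((k : ℤ) : ZMod (p ^ t)))
    rw [← solCount_eq_card] at h2
    have h3 : (Finset.univ.filter fun x : Fin n → ZMod m => (p : ZMod m) * (form M x - (k : ZMod m)) = 0)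
        = Finset.univ.filter fun x => form M (reduction n (pow_dvd_pow p t.le_succ) x)
          = ((k : ℤ) : ZMod (p ^ t)) := by
      ext x
      simp only [Finset.mem_filter, Finset.mem_univ, true_and]
      rw [natCast_mul_eq_zero_iff_castHom, form_reduction, map_sub, sub_eq_zero, map_intCast]
    rw [h3, h2] at h1
    push_cast at h1
    rw [h1]
  have e3 := sum_comp_natCast_mul G
  rw [← e1, ← e2] at e3
  have hbound : ∀ a : ZMod m, IsUnit a → ‖G a‖ ≤ √K * √((p : ℝ) ^ ((t + 1) * n)) := by
    intro a ha
    have h1 : G a = ψ (-(a * (k : ZMod m))) * ∑ x : Fin n → ZMod m, ψ (a * form M x) := by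
      rw [hG, Finset.mul_sum]
      refine Finset.sum_congr rfl fun x _ => ?_
      rw [← AddChar.map_add_eq_mul]
      congr 1; ring
    rw [h1, norm_mul, AddChar.norm_apply, one_mul, ← Real.sqrt_mul (by positivity)]
    apply Real.le_sqrt_of_sq_le
    refine (norm_sq_sum_stdAddChar_form_le M ha).trans ?_
    rw [mul_comm]
    have : ((m : ℕ) : ℝ) ^ n = (p : ℝ) ^ ((t + 1) * n) := by rw [hm]; push_cast; rw [← pow_mul]
    rw [this]
    have : ((Finset.univ.filter fun u : Fin n → ZMod m => grad M u = 0).card : ℝ) ≤ K := by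
      exact_mod_cast hK
    gcongr
  have hsum : ‖∑ a with IsUnit a, G a‖ ≤ m * (√K * √((p : ℝ) ^ ((t + 1) * n))) := by
    refine (norm_sum_le _ _).trans ((Finset.sum_le_card_nsmul _ _
      (√K * √((p : ℝ) ^ ((t + 1) * n))) ?_).trans ?_)
    · intro a ha
      exact hbound a (Finset.mem_filter.mp ha).2
    · rw [nsmul_eq_mul]
      gcongr
      refine (Finset.card_filter_le _ _).trans ?_
      rw [Finset.card_univ, ZMod.card]
  have hm0 : (0 : ℝ) < m := by rw [hm]; push_cast; positivity
  have e4 := congrArg norm e3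
  have e5 : (p : ℂ) * (solCount k M m * m) - (p : ℂ) ^ n * solCount k M (p ^ t) * m
      = ((p * m * ((solCount k M m : ℝ) - p ^ (n - 1) * solCount k M (p ^ t)) : ℝ) : ℂ) := by
    obtain ⟨l, rfl⟩ := Nat.exists_eq_add_of_le' hn
    rw [Nat.add_sub_cancel, pow_succ]
    push_cast
    ring
  rw [e5, Complex.norm_real, norm_mul, norm_mul, norm_mul (p : ℂ), Complex.norm_natCast] at e4
  rw [Real.norm_of_nonneg hp0.le, Real.norm_of_nonneg hm0.le, Real.norm_eq_abs, mul_assoc] at e4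
  have e6 := mul_left_cancel₀ hp0.ne' e4
  rw [← e6] at hsum
  exact le_of_mul_le_mul_left hsum hm0

/-- The ratio of the geometric series dominating the increments of the density sequence. -/
noncomputable def ratio (n p : ℕ) : ℝ := ((√(p : ℝ))⁻¹) ^ (n - 2)

lemma abs_densitySeq_sub_le (k : ℤ) (M : Matrix (Fin n) (Fin n) ℤ) {p t K : ℕ} [Fact p.Prime]
    (hn : 2 ≤ n)
    (hK : (Finset.univ.filter fun u : Fin n → ZMod (p ^ (t + 1)) => grad M u = 0).card ≤ K) :
    |densitySeq k M p (t + 1) - densitySeq k M p t| ≤ √K * ratio n p ^ (t + 1) := by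
  have hp0 : (0 : ℝ) < p := by exact_mod_cast (Fact.out : p.Prime).pos
  have h := abs_solCount_sub_le k M (by omega) hK
  have h1 : densitySeq k M p (t + 1) - densitySeq k M p t
      = ((solCount k M (p ^ (t + 1)) : ℝ) - p ^ (n - 1) * solCount k M (p ^ t))
        / (p : ℝ) ^ ((t + 1) * (n - 1)) := by
    rw [densitySeq, densitySeq, add_mul, one_mul, pow_add (p : ℝ)]
    generalize solCount k M (p ^ (t + 1)) = N
    field_simp
  rw [h1, abs_div, abs_of_pos (a := (p : ℝ) ^ ((t + 1) * (n - 1))) (by positivity), div_le_iff₀ (by positivity)]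
  refine h.trans (le_of_eq ?_)
  rw [mul_assoc]
  congr 1
  obtain ⟨l, rfl⟩ := Nat.exists_eq_add_of_le' hn
  have hs : √(p : ℝ) ≠ 0 := by positivity
  have h2 : (p : ℝ) = √(p : ℝ) ^ 2 := (Real.sq_sqrt hp0.le).symm
  have h3 : √((p : ℝ) ^ ((t + 1) * (l + 2))) = √(p : ℝ) ^ ((t + 1) * (l + 2)) := by
    conv_lhs => rw [h2, ← pow_mul, mul_comm, pow_mul, Real.sqrt_sq (by positivity)]
  rw [h3, ratio]
  have h4 : (p : ℝ) ^ ((t + 1) * (l + 2 - 1)) = √(p : ℝ) ^ (2 * ((t + 1) * (l + 1))) := by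
    conv_lhs => rw [h2]
    rw [← pow_mul]; congr 1
  rw [h4, inv_pow, inv_pow, Nat.add_sub_cancel, ← pow_mul, eq_inv_mul_iff_mul_eq₀ (by positivity), ← pow_add]
  congr 1
  ring

/-! ### Convergence of the local densities. -/

lemma card_grad_eq_zero_le (M : Matrix (Fin n) (Fin n) ℤ) (hM : (M + Mᵀ).det ≠ 0) (m : ℕ) [NeZero m] :
    (Finset.univ.filter fun u : Fin n → ZMod m => grad M u = 0).card
      ≤ (M + Mᵀ).det.natAbs ^ n := by
  classical
  set d := (M + Mᵀ).det
  have h1 : (Finset.univ.filter fun u : Fin n → ZMod m => grad M u = 0)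
      ⊆ Fintype.piFinset fun _ => Finset.univ.filter fun a : ZMod m => d.natAbs • a = 0 := by
    intro u hu
    rw [Fintype.mem_piFinset]
    intro i
    have h := det_smul_eq_zero_of_grad_eq_zero M (Finset.mem_filter.mp hu).2 i
    simp only [Finset.mem_filter, Finset.mem_univ, true_and]
    rw [nsmul_eq_mul, ← Int.cast_natCast]
    rcases Int.natAbs_eq d with h2 | h2
    · rw [← h2]; exact h
    · have h5 : ((d.natAbs : ℕ) : ℤ) = -d := by omega
      rw [h5, Int.cast_neg, neg_mul, h, neg_zero]
  refine (Finset.card_le_card h1).trans ?_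
  rw [Fintype.card_piFinset]
  simp only [Finset.prod_const, Finset.card_univ, Fintype.card_fin]
  exact Nat.pow_le_pow_left (IsAddCyclic.card_nsmul_eq_zero_le (Int.natAbs_pos.mpr hM)) n

lemma card_grad_eq_zero_le_one (M : Matrix (Fin n) (Fin n) ℤ) {p : ℕ} [hp : Fact p.Prime]
    (hM : ¬ (p : ℤ) ∣ (M + Mᵀ).det) (t : ℕ) :
    (Finset.univ.filter fun u : Fin n → ZMod (p ^ t) => grad M u = 0).card ≤ 1 := by
  have hu : IsUnit ((M + Mᵀ).det : ZMod (p ^ t)) := by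
    rw [ZMod.coe_int_isUnit_iff_isCoprime]
    push_cast
    exact IsCoprime.pow_left ((Nat.prime_iff_prime_int.mp hp.out).coprime_iff_not_dvd.mpr hM)
  rw [Finset.card_le_one]
  have h0 : ∀ u : Fin n → ZMod (p ^ t), grad M u = 0 → u = 0 := fun u h => by
    ext i
    exact (hu.mul_right_eq_zero).mp (det_smul_eq_zero_of_grad_eq_zero M h i)
  intro a ha b hb
  rw [h0 a (Finset.mem_filter.mp ha).2, h0 b (Finset.mem_filter.mp hb).2]

lemma ratio_nonneg (n p : ℕ) : 0 ≤ ratio n p := by unfold ratio; positivity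

lemma inv_sqrt_le_one {p : ℕ} (hp : p.Prime) : (√(p : ℝ))⁻¹ ≤ 1 := by
  apply inv_le_one_of_one_le₀
  rw [Real.one_le_sqrt]
  exact_mod_cast hp.one_lt.le

lemma inv_sqrt_sq (p : ℕ) : ((√(p : ℝ))⁻¹) ^ 2 = (p : ℝ)⁻¹ := by
  rw [inv_pow, Real.sq_sqrt (by positivity)]

lemma ratio_le_half {p : ℕ} (hp : p.Prime) (hn : 4 ≤ n) : ratio n p ≤ 1 / 2 := by
  have h2 : (2 : ℝ) ≤ p := by exact_mod_cast hp.two_le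
  calc ratio n p ≤ ((√(p : ℝ))⁻¹) ^ 2 :=
        pow_le_pow_of_le_one (by positivity) (inv_sqrt_le_one hp) (by omega)
    _ = (p : ℝ)⁻¹ := inv_sqrt_sq p
    _ ≤ 1 / 2 := by rw [one_div]; exact inv_anti₀ (by norm_num) h2

lemma densitySeq_zero (k : ℤ) (M : Matrix (Fin n) (Fin n) ℤ) (p : ℕ) : densitySeq k M p 0 = 1 := by
  have h : solCount k M (p ^ 0) = 1 := by
    rw [pow_zero, solCount, Nat.card_eq_one_iff_unique]
    exact ⟨⟨fun a b => Subsingleton.elim _ _⟩, ⟨⟨0, Subsingleton.elim _ _⟩⟩⟩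
  rw [densitySeq, h]
  simp

/-- The bound on zeros of the gradient is independent of t, so the increments are dominated by a
convergent geometric series. -/
theorem tendsto_densitySeq (k : ℤ) (M : Matrix (Fin n) (Fin n) ℤ) {p : ℕ} (hp : p.Prime)
    (hn : 4 ≤ n) (hM : (M + Mᵀ).det ≠ 0) :
    Tendsto (densitySeq k M p) atTop (𝓝 (sigma k M p)) := by
  have := Fact.mk hp
  have h := cauchySeq_of_le_geometric (ratio n p)
    (√(((M + Mᵀ).det.natAbs ^ n : ℕ) : ℝ) * ratio n p) (f := densitySeq k M p)
    (by linarith [ratio_le_half hp hn]) (fun t => by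
      rw [dist_comm, Real.dist_eq, mul_assoc, ← pow_succ']
      exact abs_densitySeq_sub_le k M (by omega) (card_grad_eq_zero_le M hM _))
  exact h.tendsto_limUnder

lemma dist_densitySeq_sigma_le (k : ℤ) (M : Matrix (Fin n) (Fin n) ℤ) {p : ℕ} (hp : p.Prime)
    (hn : 4 ≤ n) (hM : ¬ (p : ℤ) ∣ (M + Mᵀ).det) (t : ℕ) :
    |densitySeq k M p t - sigma k M p| ≤ 2 * ratio n p ^ (t + 1) := by
  have := Fact.mk hp
  have h0 : (M + Mᵀ).det ≠ 0 := fun h => hM (h ▸ dvd_zero _)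
  have hr := ratio_le_half hp hn
  have hr0 := ratio_nonneg n p
  have h := dist_le_of_le_geometric_of_tendsto (ratio n p)
    (ratio n p) (f := densitySeq k M p)
    (by linarith) (fun t => by
      rw [dist_comm, Real.dist_eq, ← pow_succ']
      simpa using abs_densitySeq_sub_le k M (K := 1) (by omega) (card_grad_eq_zero_le_one M hM _))
    (tendsto_densitySeq k M hp hn h0) t
  rw [Real.dist_eq, ← pow_succ'] at h
  refine h.trans ?_
  rw [div_le_iff₀ (by linarith)]
  have := pow_nonneg hr0 (t + 1)
  nlinarith

/-- The common bound `p ^ (-3 / 2)` for the deviation of the local densities from `1`. -/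
noncomputable def deviation (p : ℕ) : ℝ := ((√(p : ℝ))⁻¹) ^ 3

/-- Sum the increments from t = 0, where the density sequence equals 1; the first ratio is already
at most p^(-3/2) once n ≥ 5. -/
lemma abs_sigma_sub_one_le (k : ℤ) (M : Matrix (Fin n) (Fin n) ℤ) {p : ℕ} (hp : p.Prime)
    (hn : 5 ≤ n) (hM : ¬ (p : ℤ) ∣ (M + Mᵀ).det) :
    |sigma k M p - 1| ≤ 4 * deviation p := by
  have h := dist_densitySeq_sigma_le k M hp (by omega) hM 0
  rw [densitySeq_zero, abs_sub_comm, zero_add, pow_one] at h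
  have h2 : ratio n p ≤ deviation p :=
    pow_le_pow_of_le_one (by positivity) (inv_sqrt_le_one hp) (by omega)
  have := ratio_nonneg n p
  linarith

/-! ### Second moment modulo p, for four variables. -/

lemma card_dotProduct_eq {p : ℕ} [Fact p.Prime] {l : ℕ} {w : Fin (l + 1) → ZMod p} (hw : w ≠ 0)
    (c : ZMod p) :
    (Finset.univ.filter fun x : Fin (l + 1) → ZMod p => x ⬝ᵥ w = c).card = p ^ l := by
  let f : (Fin (l + 1) → ZMod p) →+ ZMod p :=
    { toFun := fun y => y ⬝ᵥ w
      map_zero' := by simp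
      map_add' := fun x y => add_dotProduct x y w }
  have hf : Function.Surjective f := by
    intro a
    obtain ⟨i, hi⟩ := Function.ne_iff.mp hw
    refine ⟨Pi.single i (a * (w i)⁻¹), ?_⟩
    have : w i ≠ 0 := hi
    simp [f, this]
  have h := card_filter_comp_mul_card f hf (fun y => y = c)
  simp only [ZMod.card, Finset.filter_eq', Finset.mem_univ, if_true, Finset.card_singleton,
    Fintype.card_pi, Finset.prod_const, Finset.card_univ, Fintype.card_fin, mul_one, pow_succ] at h
  exact Nat.eq_of_mul_eq_mul_right (Fact.out : p.Prime).pos h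

lemma sum_solCount {p : ℕ} [Fact p.Prime] (M : Matrix (Fin n) (Fin n) ℤ) :
    ∑ j : ZMod p, (Finset.univ.filter fun x : Fin n → ZMod p => form M x = j).card = p ^ n := by
  have := Finset.card_eq_sum_card_fiberwise (f := fun x : Fin n → ZMod p => form M x)
    (s := Finset.univ) (t := Finset.univ) (by intro; simp)
  rw [← this]
  simp [ZMod.card]

/-- The sum counts pairs (x, x + u) with equal values of Q. For u ≠ 0 the condition is a non-trivial
linear equation in x, with p^l solutions; u = 0 contributes all x. -/
lemma sum_solCount_sq {p : ℕ} [hp : Fact p.Prime] {l : ℕ} (M : Matrix (Fin (l + 1)) (Fin (l + 1)) ℤ)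
    (hM : ¬ (p : ℤ) ∣ (M + Mᵀ).det) :
    ∑ j : ZMod p, (Finset.univ.filter fun x : Fin (l + 1) → ZMod p => form M x = j).card ^ 2
      = p ^ (l + 1) + (p ^ (l + 1) - 1) * p ^ l := by
  have hgrad : ∀ u : Fin (l + 1) → ZMod p, grad M u = 0 → u = 0 := fun u h => by
    ext i
    have := det_smul_eq_zero_of_grad_eq_zero M h i
    rw [mul_eq_zero, ZMod.intCast_zmod_eq_zero_iff_dvd] at this
    exact this.resolve_left hM
  have h1 : ∑ j : ZMod p, (Finset.univ.filter fun x : Fin (l + 1) → ZMod p => form M x = j).card ^ 2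
      = ∑ x : Fin (l + 1) → ZMod p,
        (Finset.univ.filter fun y : Fin (l + 1) → ZMod p => form M y = form M x).card := by
    rw [← Finset.sum_fiberwise Finset.univ (fun x : Fin (l + 1) → ZMod p => form M x)]
    refine Finset.sum_congr rfl fun j _ => ?_
    rw [Finset.sum_congr rfl (g := fun _ =>
      (Finset.univ.filter fun x : Fin (l + 1) → ZMod p => form M x = j).card)]
    · rw [Finset.sum_const, smul_eq_mul, sq]
    · intro x hx
      rw [(Finset.mem_filter.mp hx).2]
  have h2 : ∀ x : Fin (l + 1) → ZMod p,
      (Finset.univ.filter fun y : Fin (l + 1) → ZMod p => form M y = form M x).card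
      = ∑ u : Fin (l + 1) → ZMod p, if x ⬝ᵥ grad M u = -form M u then 1 else 0 := by
    intro x
    rw [Finset.card_filter, ← Equiv.sum_comp (Equiv.addLeft x)]
    refine Finset.sum_congr rfl fun u _ => if_congr ?_ rfl rfl
    rw [Equiv.coe_addLeft, form_add, dotProduct_grad_comm, add_assoc, add_eq_left, add_comm,
      eq_neg_iff_add_eq_zero]
  rw [h1, Finset.sum_congr rfl fun x _ => h2 x, Finset.sum_comm,
    ← Finset.add_sum_erase _ _ (Finset.mem_univ (0 : Fin (l + 1) → ZMod p))]
  congr 1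
  · simp [grad, form, ZMod.card]
  · rw [Finset.sum_congr rfl (g := fun _ => p ^ l)]
    · rw [Finset.sum_const, Finset.card_erase_of_mem (Finset.mem_univ _), smul_eq_mul]
      simp [ZMod.card]
    · intro u hu
      rw [← Finset.card_filter]
      exact card_dotProduct_eq (fun h => (Finset.mem_erase.mp hu).1 (hgrad u h)) _

lemma sum_solCount_sub_sq_le {p : ℕ} [hp : Fact p.Prime] {l : ℕ}
    (M : Matrix (Fin (l + 1)) (Fin (l + 1)) ℤ) (hM : ¬ (p : ℤ) ∣ (M + Mᵀ).det) :
    ∑ j : ZMod p, (((Finset.univ.filter fun x : Fin (l + 1) → ZMod p => form M x = j).card : ℝ)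
      - p ^ l) ^ 2 ≤ p ^ (l + 1) := by
  have h1 : ∑ j : ZMod p, ((Finset.univ.filter fun x : Fin (l + 1) → ZMod p =>
      form M x = j).card : ℝ) = p ^ (l + 1) := by exact_mod_cast sum_solCount M
  have h2 : ∑ j : ZMod p, ((Finset.univ.filter fun x : Fin (l + 1) → ZMod p =>
      form M x = j).card : ℝ) ^ 2 = p ^ (l + 1) + (p ^ (l + 1) - 1) * p ^ l := by
    have h := congrArg (Nat.cast : ℕ → ℝ) (sum_solCount_sq M hM)
    have h3 : 1 ≤ p ^ (l + 1) := Nat.one_le_pow _ _ hp.out.pos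
    push_cast [h3] at h
    exact h
  have h3 : ∀ j : ZMod p, (((Finset.univ.filter fun x : Fin (l + 1) → ZMod p =>
      form M x = j).card : ℝ) - p ^ l) ^ 2
      = ((Finset.univ.filter fun x : Fin (l + 1) → ZMod p => form M x = j).card : ℝ) ^ 2
        - 2 * p ^ l * ((Finset.univ.filter fun x : Fin (l + 1) → ZMod p => form M x = j).card : ℝ)
        + (p ^ l) ^ 2 := fun j => by ring
  rw [Finset.sum_congr rfl fun j _ => h3 j, Finset.sum_add_distrib, Finset.sum_sub_distrib,
    ← Finset.mul_sum, h1, h2, Finset.sum_const, Finset.card_univ, ZMod.card, nsmul_eq_mul, pow_succ]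
  have : (0 : ℝ) ≤ p ^ l := by positivity
  nlinarith

lemma solCount_mul_sq {p : ℕ} [hp : Fact p.Prime] (M : Matrix (Fin n) (Fin n) ℤ) (k : ZMod p)
    {j : ZMod p} (hj : j ≠ 0) :
    (Finset.univ.filter fun x : Fin n → ZMod p => form M x = k * j ^ 2).card
      = (Finset.univ.filter fun x : Fin n → ZMod p => form M x = k).card := by
  symm
  refine Finset.card_bij (fun x _ => j • x) ?_ ?_ ?_
  · intro x hx
    simp only [Finset.mem_filter, Finset.mem_univ, true_and] at hx ⊢
    rw [form_smul, hx, mul_comm]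
  · intro x _ y _ h
    exact smul_right_injective _ hj h
  · intro y hy
    simp only [Finset.mem_filter, Finset.mem_univ, true_and] at hy
    refine ⟨j⁻¹ • y, ?_, smul_inv_smul₀ hj y⟩
    simp only [Finset.mem_filter, Finset.mem_univ, true_and]
    rw [form_smul, hy]
    field_simp

/-- The deviation at k recurs at every k j² with j ≠ 0, so its square, weighted by p - 1, is bounded
by twice the full variance. -/
lemma sub_one_mul_solCount_sub_sq_le {p : ℕ} [hp : Fact p.Prime] {l : ℕ}
    (M : Matrix (Fin (l + 1)) (Fin (l + 1)) ℤ) (hM : ¬ (p : ℤ) ∣ (M + Mᵀ).det)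
    {k : ZMod p} (hk : k ≠ 0) :
    ((p : ℝ) - 1) * (((Finset.univ.filter fun x : Fin (l + 1) → ZMod p => form M x = k).card : ℝ)
      - p ^ l) ^ 2 ≤ 2 * p ^ (l + 1) := by
  classical
  set N : ZMod p → ℝ := fun j =>
    (((Finset.univ.filter fun x : Fin (l + 1) → ZMod p => form M x = j).card : ℝ) - p ^ l) ^ 2
    with hN
  have hN0 : ∀ j, 0 ≤ N j := fun j => sq_nonneg _
  have h1 : ((p : ℝ) - 1) * N k = ∑ j ∈ Finset.univ.erase (0 : ZMod p), N (k * j ^ 2) := by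
    rw [Finset.sum_congr rfl (g := fun _ => N k)]
    · rw [Finset.sum_const, Finset.card_erase_of_mem (Finset.mem_univ _), Finset.card_univ, ZMod.card,
        nsmul_eq_mul, Nat.cast_sub hp.out.one_lt.le, Nat.cast_one]
    · intro j hj
      simp only [hN]
      rw [solCount_mul_sq M k (Finset.mem_erase.mp hj).1]
  change ((p : ℝ) - 1) * N k ≤ _
  rw [h1, Finset.sum_comp N (fun j => k * j ^ 2)]
  have hfib : ∀ b : ZMod p,
      ((Finset.univ.erase (0 : ZMod p)).filter fun j => k * j ^ 2 = b).card ≤ 2 := by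
    intro b
    rcases ((Finset.univ.erase (0 : ZMod p)).filter fun j => k * j ^ 2 = b).eq_empty_or_nonempty
      with h | ⟨a, ha⟩
    · rw [h]; simp
    · refine (Finset.card_le_card (t := {a, -a}) ?_).trans Finset.card_le_two
      intro j hj
      have e1 := (Finset.mem_filter.mp hj).2
      have e2 := (Finset.mem_filter.mp ha).2
      have e3 : j ^ 2 = a ^ 2 := mul_left_cancel₀ hk (e1.trans e2.symm)
      simpa using sq_eq_sq_iff_eq_or_eq_neg.mp e3
  calc _ ≤ ∑ b ∈ Finset.image (fun j => k * j ^ 2) (Finset.univ.erase (0 : ZMod p)), 2 * N b := by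
        refine Finset.sum_le_sum fun b _ => ?_
        rw [nsmul_eq_mul]
        have : (((Finset.univ.erase (0 : ZMod p)).filter fun j => k * j ^ 2 = b).card : ℝ) ≤ 2 := by
          exact_mod_cast hfib b
        exact mul_le_mul_of_nonneg_right this (hN0 b)
    _ ≤ ∑ b, 2 * N b := Finset.sum_le_sum_of_subset_of_nonneg (Finset.subset_univ _)
        fun b _ _ => mul_nonneg zero_le_two (hN0 b)
    _ ≤ _ := by
      rw [← Finset.mul_sum]
      exact mul_le_mul_of_nonneg_left (sum_solCount_sub_sq_le M hM) zero_le_two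

lemma abs_densitySeq_one_sub_one_le (k : ℤ) (M : Matrix (Fin 4) (Fin 4) ℤ) {p : ℕ} (hp : p.Prime)
    (hM : ¬ (p : ℤ) ∣ (M + Mᵀ).det) (hk : ¬ (p : ℤ) ∣ k) :
    |densitySeq k M p 1 - 1| ≤ 2 * deviation p := by
  have := Fact.mk hp
  have hk' : (k : ZMod p) ≠ 0 := fun h => hk ((ZMod.intCast_zmod_eq_zero_iff_dvd k p).mp h)
  have h := sub_one_mul_solCount_sub_sq_le M hM hk'
  have h2 : solCount k M (p ^ 1)
      = (Finset.univ.filter fun x : Fin 4 → ZMod p => form M x = (k : ZMod p)).card := by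
    rw [pow_one, solCount_eq_card]
  rw [← h2] at h
  have hp2 : (2 : ℝ) ≤ p := by exact_mod_cast hp.two_le
  have h3 : densitySeq k M p 1 - 1 = ((solCount k M (p ^ 1) : ℝ) - p ^ 3) / p ^ 3 := by
    
    rw [densitySeq, show 1 * (4 - 1) = 3 from rfl, div_sub_one (by positivity)]
  rw [h3]
  apply abs_le_of_sq_le_sq _ (by unfold deviation; positivity)
  have h4 : (2 * deviation p) ^ 2 = 4 / (p : ℝ) ^ 3 := by
    rw [deviation, mul_pow, ← pow_mul, mul_comm 3 2, pow_mul, inv_sqrt_sq, inv_pow]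
    ring
  rw [h4, div_pow, div_le_div_iff₀ (by positivity) (by positivity)]
  have h5 : ((solCount k M (p ^ 1) : ℝ) - p ^ 3) ^ 2 ≤ 4 * p ^ 3 := by
    have h6 := sq_nonneg ((solCount k M (p ^ 1) : ℝ) - p ^ 3)
    have h7 : (p : ℝ) / 2 * ((solCount k M (p ^ 1) : ℝ) - p ^ 3) ^ 2 ≤ p / 2 * (4 * p ^ 3) := by
      calc _ ≤ ((p : ℝ) - 1) * ((solCount k M (p ^ 1) : ℝ) - p ^ 3) ^ 2 := by
            gcongr; linarith
        _ ≤ _ := h.trans (le_of_eq (by ring))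
    exact le_of_mul_le_mul_left h7 (by linarith)
  calc _ ≤ (4 * (p : ℝ) ^ 3) * p ^ 3 := by gcongr
    _ = _ := by ring

/-- The second moment handles t = 1, and the geometric tail beyond t = 1 starts with the square of
the ratio, namely p^(-2). -/
lemma abs_sigma_sub_one_le_of_four (k : ℤ) (M : Matrix (Fin 4) (Fin 4) ℤ) {p : ℕ} (hp : p.Prime)
    (hM : ¬ (p : ℤ) ∣ (M + Mᵀ).det) (hk : ¬ (p : ℤ) ∣ k) :
    |sigma k M p - 1| ≤ 4 * deviation p := by
  have h1 := abs_densitySeq_one_sub_one_le k M hp hM hk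
  have h2 := dist_densitySeq_sigma_le k M hp le_rfl hM 1
  have h3 : ratio 4 p ^ 2 ≤ deviation p := by
    rw [ratio, ← pow_mul]
    exact pow_le_pow_of_le_one (by positivity) (inv_sqrt_le_one hp) (by omega)
  have h4 : |sigma k M p - 1| ≤ |densitySeq k M p 1 - 1| + |densitySeq k M p 1 - sigma k M p| := by
    rw [abs_sub_comm (densitySeq k M p 1) (sigma k M p), add_comm]
    exact abs_sub_le _ _ _
  norm_num at h2
  linarith

/-! ### Hensel lifting. -/

/-- Every residue class is a value of `y ↦ p a y² + b y` when `p ∤ b`. -/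
lemma exists_pow_dvd_of_unit_linear_coeff {p : ℕ} (hp : p.Prime) (a b c : ℤ) (hb : ¬ (p : ℤ) ∣ b)
    (t : ℕ) : ∃ y : ℤ, (p : ℤ) ^ t ∣ p * a * y ^ 2 + b * y + c := by
  have : NeZero (p ^ t) := ⟨(pow_pos hp.pos t).ne'⟩
  set f : ZMod (p ^ t) → ZMod (p ^ t) := fun y => (p : ZMod (p ^ t)) * a * y ^ 2 + b * y with hf
  have hinj : Function.Injective f := by
    intro y z hyz
    obtain ⟨y, rfl⟩ := ZMod.intCast_surjective y
    obtain ⟨z, rfl⟩ := ZMod.intCast_surjective z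
    -- The difference of the values at y and z is y - z times this factor, which is a unit because p
    -- ∤ b. Injectivity on a finite set then gives surjectivity.
    have hu : IsUnit (((p : ℤ) * a * (y + z) + b : ℤ) : ZMod (p ^ t)) := by
      rw [ZMod.coe_int_isUnit_iff_isCoprime]
      push_cast
      refine IsCoprime.pow_left ((Nat.prime_iff_prime_int.mp hp).coprime_iff_not_dvd.mpr ?_)
      rwa [mul_assoc, dvd_add_right (dvd_mul_right _ _)]
    have h : (((p : ℤ) * a * (y + z) + b : ℤ) : ZMod (p ^ t)) * ((y : ZMod (p ^ t)) - z) = 0 := by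
      simp only [hf] at hyz
      push_cast
      linear_combination hyz
    exact sub_eq_zero.mp ((hu.mul_right_eq_zero).mp h)
  obtain ⟨y, hy⟩ := Finite.injective_iff_surjective.mp hinj (-c)
  obtain ⟨y, rfl⟩ := ZMod.intCast_surjective y
  refine ⟨y, ?_⟩
  rw [← Nat.cast_pow, ← ZMod.intCast_zmod_eq_zero_iff_dvd]
  simp only [hf] at hy
  push_cast
  rw [hy]; ring

/-- With v ≤ w the exact power of p in b, the substitution z = p^(v+1) y makes everything divisible
by p^(2v+1), and the quotient is a quadratic with unit linear coefficient and leading coefficient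
divisible by p. -/
lemma exists_pow_dvd_quadratic {p : ℕ} (hp : p.Prime) (a b c : ℤ) (w : ℕ)
    (hb : ¬ (p : ℤ) ^ (1 + w) ∣ b) (hc : (p : ℤ) ^ (1 + 2 * w) ∣ c) (t : ℕ) :
    ∃ z : ℤ, (p : ℤ) ∣ z ∧ (p : ℤ) ^ t ∣ a * z ^ 2 + b * z + c := by
  have hb0 : b ≠ 0 := by rintro rfl; exact hb (dvd_zero _)
  have hfin : FiniteMultiplicity (p : ℤ) b :=
    Int.finiteMultiplicity_iff.mpr ⟨by simpa using hp.ne_one, hb0⟩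
  obtain ⟨b', hb', hnd⟩ := hfin.exists_eq_pow_mul_and_not_dvd
  set v := multiplicity (p : ℤ) b
  have hv : v ≤ w := by
    by_contra h
    apply hb
    rw [hb']
    exact (pow_dvd_pow _ (by omega)).mul_right _
  obtain ⟨c', hc'⟩ := (pow_dvd_pow (p : ℤ) (show 2 * v + 1 ≤ 1 + 2 * w by omega)).trans hc
  obtain ⟨y, hy⟩ := exists_pow_dvd_of_unit_linear_coeff hp a b' c' hnd t
  refine ⟨p ^ (v + 1) * y, (dvd_pow_self _ (by omega)).mul_right _, ?_⟩
  have : a * (p ^ (v + 1) * y) ^ 2 + b * (p ^ (v + 1) * y) + c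
      = p ^ (2 * v + 1) * (p * a * y ^ 2 + b' * y + c') := by
    conv_lhs => rw [hb', hc']
    ring
  rw [this]
  exact hy.mul_left _

/-- Solubility of `Q ≡ k` at the prime `p` to a precision at which Hensel's lemma applies, in terms
of the gradient of `Q`. -/
def SmoothlySoluble (k : ℤ) (M : Matrix (Fin n) (Fin n) ℤ) (p : ℕ) : Prop :=
  ∃ x : Fin n → ℤ, form M x ≡ k [ZMOD (p : ℤ) ^ (1 + 2 * tau p)] ∧
    ∃ i, ¬ (p : ℤ) ^ (1 + tau p) ∣ grad M x i

lemma form_modEq (M : Matrix (Fin n) (Fin n) ℤ) {m : ℤ} {x y : Fin n → ℤ}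
    (h : ∀ i, x i ≡ y i [ZMOD m]) : form M x ≡ form M y [ZMOD m] := by
  have h1 : ((m.natAbs : ℕ) : ℤ) ∣ m := by simp
  rw [← Int.modEq_natAbs]
  rw [← ZMod.intCast_eq_intCast_iff, ← form_intCast, ← form_intCast]
  congr 1
  ext i
  rw [ZMod.intCast_eq_intCast_iff, Int.modEq_natAbs]
  exact h i

lemma grad_modEq (M : Matrix (Fin n) (Fin n) ℤ) {m : ℤ} {x y : Fin n → ℤ}
    (h : ∀ i, x i ≡ y i [ZMOD m]) (i : Fin n) : grad M x i ≡ grad M y i [ZMOD m] := by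
  rw [← Int.modEq_natAbs]
  rw [← ZMod.intCast_eq_intCast_iff, ← grad_intCast, ← grad_intCast]
  congr 1
  ext i
  rw [ZMod.intCast_eq_intCast_iff, Int.modEq_natAbs]
  exact h i

lemma exists_lift_along_coordinate (k : ℤ) (M : Matrix (Fin n) (Fin n) ℤ) {p : ℕ} (hp : p.Prime)
    {w : ℕ} {y : Fin n → ℤ} {i : Fin n} (hy : form M y ≡ k [ZMOD (p : ℤ) ^ (1 + 2 * w)])
    (hi : ¬ (p : ℤ) ^ (1 + w) ∣ grad M y i) (t : ℕ) :
    ∃ x : Fin n → ℤ, (∀ j, j ≠ i → x j = y j) ∧ x i ≡ y i [ZMOD p] ∧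
      form M x ≡ k [ZMOD (p : ℤ) ^ t] := by
  obtain ⟨z, hz, hzt⟩ := exists_pow_dvd_quadratic hp (form M (Pi.single i 1)) (grad M y i)
    (form M y - k) w hi hy.symm.dvd t
  refine ⟨y + z • Pi.single i 1, ?_, ?_, ?_⟩
  · intro j hj
    simp [hj]
  · simpa [Int.modEq_iff_dvd] using hz
  · rw [form_add, form_smul, smul_dotProduct, single_one_dotProduct]
    apply Int.ModEq.symm
    rw [Int.modEq_iff_dvd]
    convert hzt using 1
    rw [smul_eq_mul]
    ring

/-- All coordinates but the i-th may be moved freely within their classes modulo p^(1+2w); the i-th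
is then solved for by Hensel's lemma. -/
lemma pow_le_card_lifts (k : ℤ) {l : ℕ} (M : Matrix (Fin (l + 1)) (Fin (l + 1)) ℤ) {p : ℕ}
    [hp : Fact p.Prime] {w : ℕ} {x₀ : Fin (l + 1) → ℤ} {i : Fin (l + 1)}
    (hx : form M x₀ ≡ k [ZMOD (p : ℤ) ^ (1 + 2 * w)]) (hi : ¬ (p : ℤ) ^ (1 + w) ∣ grad M x₀ i)
    {t : ℕ} (ht : 1 + 2 * w ≤ t) (hpt : p ∣ p ^ t) :
    p ^ ((t - (1 + 2 * w)) * l) ≤ (Finset.univ.filter fun x : Fin (l + 1) → ZMod (p ^ t) =>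
      form M x = (k : ZMod (p ^ t)) ∧ reduction (l + 1) hpt x = fun j => (x₀ j : ZMod p)).card := by
  set e := 1 + 2 * w with he
  -- The inserted 0 leaves coordinate i unperturbed. The other coordinates survive the lift, so they
  -- recover z.
  set y : (Fin l → Fin (p ^ (t - e))) → Fin (l + 1) → ℤ := fun z j =>
    x₀ j + p ^ e * i.insertNth (α := fun _ => ℤ) 0 (fun j => ((z j : ℕ) : ℤ)) j with hy
  have hyx : ∀ z j, y z j ≡ x₀ j [ZMOD (p : ℤ) ^ e] := fun z j => by
    simp [hy, Int.modEq_iff_dvd]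
  have hlift : ∀ z, ∃ x : Fin (l + 1) → ℤ, (∀ j, j ≠ i → x j = y z j) ∧ x i ≡ y z i [ZMOD p] ∧
      form M x ≡ k [ZMOD (p : ℤ) ^ t] := by
    intro z
    refine exists_lift_along_coordinate k M hp.out ((form_modEq M (hyx z)).trans hx) ?_ t
    intro h
    apply hi
    have h2 := (grad_modEq M (hyx z) i).of_dvd (pow_dvd_pow (p : ℤ) (show 1 + w ≤ e by omega))
    exact h2.dvd_iff.mp h
  choose X hX1 hX2 hX3 using hlift
  have hcard : p ^ ((t - e) * l) = (Finset.univ : Finset (Fin l → Fin (p ^ (t - e)))).card := by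
    simp [pow_mul]
  rw [hcard]
  refine Finset.card_le_card_of_injOn (fun z j => ((X z j : ℤ) : ZMod (p ^ t))) ?_ ?_
  · intro z _
    simp only [Finset.coe_filter, Finset.mem_univ, true_and, Set.mem_ofPred_eq]
    refine ⟨?_, ?_⟩
    · rw [form_intCast, ZMod.intCast_eq_intCast_iff]
      exact_mod_cast hX3 z
    · ext j
      change ZMod.castHom hpt (ZMod p) _ = _
      rw [map_intCast, ZMod.intCast_eq_intCast_iff]
      have h1 : y z j ≡ x₀ j [ZMOD p] := (hyx z j).of_dvd (dvd_pow_self _ (by omega))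
      by_cases hj : j = i
      · subst hj; exact (hX2 z).trans h1
      · rw [hX1 z j hj]; exact h1
  · intro z _ z' _ h
    ext j
    have hne : i.succAbove j ≠ i := Fin.succAbove_ne i j
    have h1 := congrFun h (i.succAbove j)
    simp only at h1
    rw [hX1 _ _ hne, hX1 _ _ hne, ZMod.intCast_eq_intCast_iff] at h1
    simp only [hy, Fin.insertNth_apply_succAbove] at h1
    have h2 := (Int.ModEq.add_left_cancel' _ h1)
    obtain ⟨s, rfl⟩ := Nat.exists_eq_add_of_le ht
    have hpe : (0 : ℤ) < (p : ℤ) ^ e := pow_pos (by exact_mod_cast hp.out.pos) _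
    push_cast at h2
    rw [pow_add] at h2
    have h3 := Int.ModEq.mul_left_cancel' hpe.ne' h2
    have h4 : ((z j : ℕ)) ≡ (z' j : ℕ) [MOD p ^ s] := by
      rw [← Int.natCast_modEq_iff]; exact_mod_cast h3
    have e0 : p ^ (e + s - e) = p ^ s := by rw [Nat.add_sub_cancel_left]
    have e1 := (z j).isLt.trans_eq e0
    have e2 := (z' j).isLt.trans_eq e0
    exact h4.eq_of_lt_of_lt e1 e2

lemma pow_le_solCount_of_smoothlySoluble (k : ℤ) {l : ℕ}
    (M : Matrix (Fin (l + 1)) (Fin (l + 1)) ℤ) {p : ℕ} [hp : Fact p.Prime]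
    (h : SmoothlySoluble k M p) {t : ℕ} (ht : 1 + 2 * tau p ≤ t) :
    p ^ ((t - (1 + 2 * tau p)) * l) ≤ solCount k M (p ^ t) := by
  obtain ⟨x₀, hx, i, hi⟩ := h
  refine (pow_le_card_lifts k M hx hi ht (dvd_pow_self p (by omega))).trans ?_
  rw [solCount_eq_card]
  exact Finset.card_le_card (Finset.monotone_filter_right _ fun x _ h => h.1)

lemma card_smooth_mul_pow_le_solCount (k : ℤ) {l : ℕ}
    (M : Matrix (Fin (l + 1)) (Fin (l + 1)) ℤ) {p : ℕ} [hp : Fact p.Prime] {t : ℕ} (ht : 1 ≤ t) :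
    (Finset.univ.filter fun x : Fin (l + 1) → ZMod p =>
      form M x = (k : ZMod p) ∧ grad M x ≠ 0).card * p ^ ((t - 1) * l) ≤ solCount k M (p ^ t) := by
  classical
  have hpt : p ∣ p ^ t := dvd_pow_self p (by omega)
  set T := (Finset.univ.filter fun x : Fin (l + 1) → ZMod p =>
      form M x = (k : ZMod p) ∧ grad M x ≠ 0) with hT
  rw [solCount_eq_card]
  set U := (Finset.univ.filter fun x : Fin (l + 1) → ZMod (p ^ t) =>
    form M x = (k : ZMod (p ^ t))) with hU
  calc T.card * p ^ ((t - 1) * l) = ∑ s ∈ T, p ^ ((t - 1) * l) := by simp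
    _ ≤ ∑ s ∈ T, (U.filter fun x => reduction (l + 1) hpt x = s).card := by
      refine Finset.sum_le_sum fun s hs => ?_
      obtain ⟨h1, h2⟩ := (Finset.mem_filter.mp hs).2
      choose x₀ hx₀ using fun j => ZMod.intCast_surjective (s j)
      have hs' : s = fun j => (x₀ j : ZMod p) := funext fun j => (hx₀ j).symm
      obtain ⟨i, hi⟩ := Function.ne_iff.mp h2
      subst hs'
      rw [form_intCast, ZMod.intCast_eq_intCast_iff] at h1
      rw [grad_intCast] at hi
      have hi' : ¬ (p : ℤ) ^ (1 + 0) ∣ grad M x₀ i := fun h => hi (by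
        rw [add_zero, pow_one] at h
        exact (ZMod.intCast_zmod_eq_zero_iff_dvd _ _).mpr h)
      have := pow_le_card_lifts k M (w := 0) (x₀ := x₀) (i := i) (by simpa using h1) hi' (by simpa using ht) hpt
      rw [hU, Finset.filter_filter]
      exact this
    _ = (T.biUnion fun s => U.filter fun x => reduction (l + 1) hpt x = s).card := by
      rw [Finset.card_biUnion]
      intro a _ b _ hab
      rw [Function.onFun, Finset.disjoint_left]
      intro x hx hx'
      exact hab ((Finset.mem_filter.mp hx).2.symm.trans (Finset.mem_filter.mp hx').2)
    _ ≤ U.card := by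
      apply Finset.card_le_card
      intro x hx
      obtain ⟨s, -, hs⟩ := Finset.mem_biUnion.mp hx
      exact (Finset.mem_filter.mp hs).1

/-! ### Lower bound for the density from a smooth solution. -/

lemma totalDegree_form_le {F : Type*} [Field F] {σ : Type*} (M : Matrix (Fin n) (Fin n) ℤ)
    (y : Fin n → MvPolynomial σ F) (hy : ∀ i, (y i).totalDegree ≤ 1) :
    (form M y).totalDegree ≤ 2 := by
  rw [form, dotProduct]
  refine MvPolynomial.totalDegree_finsetSum_le fun i _ => ?_
  refine (MvPolynomial.totalDegree_mul _ _).trans (add_le_add (b := 1) (d := 1) (hy i) ?_)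
  rw [Matrix.mulVec, dotProduct]
  refine MvPolynomial.totalDegree_finsetSum_le fun j _ => ?_
  refine (MvPolynomial.totalDegree_mul _ _).trans ?_
  rw [Matrix.map_apply, ← map_intCast (MvPolynomial.C (σ := σ) (R := F)), MvPolynomial.totalDegree_C,
    zero_add]
  exact hy j

/-- Lines through a smooth point of a quadric give many smooth points. -/
lemma two_mul_pow_le_card_smooth {p : ℕ} [hp : Fact p.Prime] (hp5 : 5 ≤ p) {l : ℕ}
    (M : Matrix (Fin (l + 1)) (Fin (l + 1)) ℤ) {x₀ : Fin (l + 1) → ZMod p} (hx₀ : grad M x₀ ≠ 0) :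
    2 * p ^ l ≤ 5 * (Finset.univ.filter fun x : Fin (l + 1) → ZMod p =>
      form M x = form M x₀ ∧ grad M x ≠ 0).card := by
  classical
  set T := Finset.univ.filter fun x : Fin (l + 1) → ZMod p => form M x = form M x₀ ∧ grad M x ≠ 0
    with hT
  set g := grad M x₀ with hg
  set Qp : MvPolynomial (Fin (l + 1)) (ZMod p) := form M MvPolynomial.X with hQp
  set Lp : MvPolynomial (Fin (l + 1)) (ZMod p) := ∑ i, MvPolynomial.C (g i) * MvPolynomial.X i with hLp
  have evQ : ∀ v, MvPolynomial.eval v Qp = form M v := fun v => by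
    rw [hQp, map_form]; simp
  have evL : ∀ v, MvPolynomial.eval v Lp = v ⬝ᵥ g := fun v => by
    rw [hLp, map_sum, dotProduct]
    exact Finset.sum_congr rfl fun i _ => by simp [mul_comm]
  obtain ⟨i, hi⟩ := Function.ne_iff.mp hx₀
  have hL0 : Lp ≠ 0 := by
    intro h
    have := evL (Pi.single i 1)
    rw [h, map_zero, single_one_dotProduct] at this
    exact hi this.symm
  have hQ0 : Qp ≠ 0 := by
    intro h
    have h0 : ∀ v, form M v = (0 : ZMod p) := fun v => by rw [← evQ, h, map_zero]
    have := form_add M x₀ (Pi.single i 1)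
    rw [h0, h0, h0, single_one_dotProduct, zero_add, zero_add] at this
    exact hi this.symm
  -- Directions to avoid are those with v·g = 0 or Q(v) = 0: the zeros of a cubic, at most 3p^l of
  -- them by Schwartz–Zippel.
  have hdeg : (Lp * Qp).totalDegree ≤ 3 := by
    refine (MvPolynomial.totalDegree_mul _ _).trans (add_le_add (a := Lp.totalDegree) (b := 1)
      (d := 2) ?_ ?_)
    · refine MvPolynomial.totalDegree_finsetSum_le fun j _ => ?_
      refine (MvPolynomial.totalDegree_mul _ _).trans ?_
      rw [MvPolynomial.totalDegree_C, MvPolynomial.totalDegree_X]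
    · exact totalDegree_form_le M _ fun j => (MvPolynomial.totalDegree_X _).le
  have hsz := MvPolynomial.schwartz_zippel_totalDegree (mul_ne_zero hL0 hQ0) Finset.univ
  set Z := Finset.univ.filter fun v : Fin (l + 1) → ZMod p => (v ⬝ᵥ g) * form M v = 0 with hZ
  set V := Finset.univ.filter fun v : Fin (l + 1) → ZMod p => ¬ (v ⬝ᵥ g) * form M v = 0 with hV
  have hZcard : Z.card ≤ 3 * p ^ l := by
    have h1 : (Finset.filter (fun f => MvPolynomial.eval f (Lp * Qp) = 0)
        (Fintype.piFinset fun _ : Fin (l + 1) => (Finset.univ : Finset (ZMod p)))) = Z := by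
      ext v
      simp [hZ, evL, evQ]
    rw [h1, Finset.card_univ, ZMod.card] at hsz
    have hp0 : (0 : ℚ≥0) < p := by exact_mod_cast hp.out.pos
    rw [div_le_div_iff₀ (by positivity) hp0, pow_succ, ← mul_assoc] at hsz
    have h2 := le_of_mul_le_mul_right hsz hp0
    have h3 : (((Lp * Qp).totalDegree : ℕ) : ℚ≥0) ≤ 3 := by exact_mod_cast hdeg
    have h4 : (Z.card : ℚ≥0) ≤ 3 * p ^ l := h2.trans (by gcongr)
    exact_mod_cast h4
  have hVcard : V.card ≤ p * T.card := by
    -- The second intersection of the line x₀ + λv with the quadric: λ v·g + λ² Q(v) = 0 with λ ≠ 0.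
    set φ : (Fin (l + 1) → ZMod p) → (Fin (l + 1) → ZMod p) := fun v =>
      x₀ + (-(v ⬝ᵥ g) * (form M v)⁻¹) • v with hφ
    have hmaps : V.image φ ⊆ T := by
      intro b hb
      obtain ⟨v, hv, rfl⟩ := Finset.mem_image.mp hb
      have hv' := (Finset.mem_filter.mp hv).2
      obtain ⟨hv1, hv2⟩ := not_or.mp (fun h => hv' (mul_eq_zero.mpr h))
      simp only [hT, Finset.mem_filter, Finset.mem_univ, true_and]
      constructor
      · simp only [hφ]
        rw [form_add, form_smul, smul_dotProduct, smul_eq_mul, ← hg]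
        field_simp
        ring
      -- The derivative along v at the second intersection is -(v·g), hence non-zero.
      · intro h0
        have h1 : v ⬝ᵥ grad M (φ v) = 0 := by rw [h0, dotProduct_zero]
        simp only [hφ] at h1
        rw [grad_add, grad_smul, dotProduct_add, dotProduct_smul, dotProduct_grad_self, smul_eq_mul,
          ← hg] at h1
        apply hv1
        field_simp at h1
        linear_combination -h1
    refine (Finset.card_le_mul_card_image (f := φ) V p ?_).trans
      (Nat.mul_le_mul_left _ (Finset.card_le_card hmaps))
    intro b _
    -- A direction leading to b is a scalar multiple of b - x₀, so there are at most p of them.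
    refine (Finset.card_le_card (t := Finset.univ.image fun d : ZMod p => d • (b - x₀)) ?_).trans
      (Finset.card_image_le.trans (by rw [Finset.card_univ, ZMod.card]))
    intro v hv
    obtain ⟨hvV, rfl⟩ := Finset.mem_filter.mp hv
    have hv' := (Finset.mem_filter.mp hvV).2
    obtain ⟨hv1, hv2⟩ := not_or.mp (fun h => hv' (mul_eq_zero.mpr h))
    refine Finset.mem_image.mpr ⟨(-(v ⬝ᵥ g) * (form M v)⁻¹)⁻¹, Finset.mem_univ _, ?_⟩
    simp only [hφ, add_sub_cancel_left]
    exact inv_smul_smul₀ (mul_ne_zero (neg_ne_zero.mpr hv1) (inv_ne_zero hv2)) v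
  have htot : Z.card + V.card = p ^ (l + 1) := by
    rw [hZ, hV, Finset.card_filter_add_card_filter_not]
    simp [ZMod.card]
  rw [pow_succ] at htot
  have h1 : p * p ^ l ≤ 3 * p ^ l + p * T.card := by linarith
  have hp0 := hp.out.pos
  have h3 : 5 * (3 * p ^ l) ≤ 3 * (p * p ^ l) := by
    have := Nat.mul_le_mul_right (p ^ l) hp5
    linarith
  have h2 : p * (2 * p ^ l) ≤ p * (5 * T.card) := by linarith
  exact Nat.le_of_mul_le_mul_left h2 hp0

/-- The lower bound for a local density coming from a smooth solution. -/
noncomputable def smoothBound (n : ℕ) : ℝ := ((8 : ℝ) ^ (n - 1))⁻¹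

lemma smoothBound_pos (n : ℕ) : 0 < smoothBound n := by unfold smoothBound; positivity

lemma smoothBound_le_densitySeq (k : ℤ) (M : Matrix (Fin n) (Fin n) ℤ) {p : ℕ} (hp : p.Prime)
    (hn : 2 ≤ n) (h : SmoothlySoluble k M p) {t : ℕ} (ht : 3 ≤ t) :
    smoothBound n ≤ densitySeq k M p t := by
  have := Fact.mk hp
  have hp0 : (0 : ℝ) < p := by exact_mod_cast hp.pos
  obtain ⟨l, rfl⟩ := Nat.exists_eq_add_of_le' (show 1 ≤ n by omega)
  rw [densitySeq, smoothBound, Nat.add_sub_cancel, le_div_iff₀ (by positivity)]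
  -- Lifting one solution only gives p^(-(n-1)), which is not uniform in p. For p ≥ 5 the proportion
  -- 2/5 of smooth points is used instead; for p = 2, 3 the loss is harmless because p^(1+2τ) ≤ 8.
  by_cases hp5 : 5 ≤ p
  · have htau : tau p = 0 := by rw [tau, if_neg (by omega)]
    obtain ⟨x, hx, i, hi⟩ := h
    rw [htau] at hx hi
    have hx0 : grad M (fun j => (x j : ZMod p)) ≠ 0 := fun h0 => hi (by
      rw [add_zero, pow_one, ← ZMod.intCast_zmod_eq_zero_iff_dvd, ← grad_intCast, h0]
      rfl)
    have h1 := two_mul_pow_le_card_smooth hp5 M hx0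
    have h2 : form M (fun j => (x j : ZMod p)) = (k : ZMod p) := by
      rw [form_intCast, ZMod.intCast_eq_intCast_iff]
      simpa using hx
    rw [h2] at h1
    have h3 := card_smooth_mul_pow_le_solCount k M (p := p) (t := t) (by omega)
    set T := (Finset.univ.filter fun x : Fin (l + 1) → ZMod p =>
      form M x = (k : ZMod p) ∧ grad M x ≠ 0).card
    have h4 : (T : ℝ) * p ^ ((t - 1) * l) ≤ solCount k M (p ^ t) := by exact_mod_cast h3
    have h5 : 2 * (p : ℝ) ^ l ≤ 5 * T := by exact_mod_cast h1
    refine le_trans ?_ h4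
    have h6 : (p : ℝ) ^ (t * l) = p ^ l * p ^ ((t - 1) * l) := by
      rw [← pow_add, ← _root_.one_add_mul, Nat.add_sub_cancel' (by omega)]
    rw [h6, ← mul_assoc]
    gcongr
    have h7 : ((8 : ℝ) ^ l)⁻¹ ≤ 2 / 5 := by
      obtain ⟨l', rfl⟩ := Nat.exists_eq_add_of_le' (show 1 ≤ l by omega)
      calc ((8 : ℝ) ^ (l' + 1))⁻¹ ≤ (8 ^ 1)⁻¹ := by gcongr <;> norm_num
        _ ≤ 2 / 5 := by norm_num
    have h8 := mul_le_mul_of_nonneg_right h7 (pow_nonneg hp0.le l)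
    linarith
  · have he : p ^ (1 + 2 * tau p) ≤ 8 ∧ 1 + 2 * tau p ≤ 3 := by
      have h2 := hp.two_le
      have h4 : p ≤ 4 := by omega
      interval_cases p <;> simp [tau]
    have h1 := pow_le_solCount_of_smoothlySoluble k M h (t := t) (by omega)
    have h2 : (p : ℝ) ^ ((t - (1 + 2 * tau p)) * l) ≤ solCount k M (p ^ t) := by exact_mod_cast h1
    refine le_trans ?_ h2
    rw [inv_mul_le_iff₀ (by positivity)]
    have h3 : (p : ℝ) ^ (t * l) = (p ^ (1 + 2 * tau p)) ^ l * p ^ ((t - (1 + 2 * tau p)) * l) := by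
      rw [← pow_mul, ← pow_add, ← Nat.add_mul]
      congr 2; omega
    rw [h3]
    have h4 : (p : ℝ) ^ (1 + 2 * tau p) ≤ 8 := by exact_mod_cast he.1
    gcongr

lemma smoothBound_le_sigma (k : ℤ) (M : Matrix (Fin n) (Fin n) ℤ) {p : ℕ} (hp : p.Prime)
    (hn : 4 ≤ n) (hM : (M + Mᵀ).det ≠ 0) (h : SmoothlySoluble k M p) :
    smoothBound n ≤ sigma k M p :=
  ge_of_tendsto (tendsto_densitySeq k M hp hn hM)
    (eventually_atTop.mpr ⟨3, fun _ ht => smoothBound_le_densitySeq k M hp (by omega) h ht⟩)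

/-! ### Descent at primes without a smooth solution. -/

/-- A quadratic form over `𝔽_p` has a nontrivial zero on every subspace of dimension three. -/
lemma exists_ne_zero_form_eq_zero {p : ℕ} [hp : Fact p.Prime] (M : Matrix (Fin n) (Fin n) ℤ)
    (W : Submodule (ZMod p) (Fin n → ZMod p)) (hW : 3 ≤ Module.finrank (ZMod p) W) :
    ∃ x ∈ W, x ≠ 0 ∧ form M x = 0 := by
  classical
  set w : Fin 3 → W := fun i => Module.finBasis (ZMod p) W (Fin.castLE hW i) with hw
  have hli : LinearIndependent (ZMod p) w :=
    (Module.finBasis (ZMod p) W).linearIndependent.comp _ (Fin.castLE_injective hW)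
  set y : Fin n → MvPolynomial (Fin 3) (ZMod p) := fun j =>
    ∑ i, MvPolynomial.C ((w i : Fin n → ZMod p) j) * MvPolynomial.X i with hy
  have ev : ∀ a : Fin 3 → ZMod p, MvPolynomial.eval a (form M y)
      = form M (((∑ i, a i • w i : W) : Fin n → ZMod p)) := by
    intro a
    rw [map_form]
    congr 1
    ext j
    simp [hy, Finset.sum_apply, mul_comm]
  have hdeg : (form M y).totalDegree < Fintype.card (Fin 3) := by
    refine lt_of_le_of_lt (totalDegree_form_le M y fun j => ?_) (by simp)
    refine MvPolynomial.totalDegree_finsetSum_le fun i _ => ?_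
    refine (MvPolynomial.totalDegree_mul _ _).trans ?_
    rw [MvPolynomial.totalDegree_C, MvPolynomial.totalDegree_X]
  -- Chevalley–Warning: degree 2 in 3 variables, and the zero vector is one solution.
  have hdvd := char_dvd_card_solutions p hdeg
  have h0 : MvPolynomial.eval (0 : Fin 3 → ZMod p) (form M y) = 0 := by
    rw [ev]; simp [form_zero]
  have hpos : 0 < Fintype.card {a : Fin 3 → ZMod p // MvPolynomial.eval a (form M y) = 0} :=
    Fintype.card_pos_iff.mpr ⟨⟨0, h0⟩⟩
  have hlt : 1 < Fintype.card {a : Fin 3 → ZMod p // MvPolynomial.eval a (form M y) = 0} :=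
    hp.out.one_lt.trans_le (Nat.le_of_dvd hpos hdvd)
  obtain ⟨⟨a, ha⟩, hne⟩ := Fintype.exists_ne_of_one_lt_card hlt ⟨0, h0⟩
  have ha0 : a ≠ 0 := fun h => hne (Subtype.ext h)
  refine ⟨_, (∑ i, a i • w i : W).2, ?_, by rw [← ev, ha]⟩
  intro h
  apply ha0
  ext i
  exact Fintype.linearIndependent_iff.mp hli a (Subtype.ext h) i

/-- Without smooth zeros, the zeros of a quadratic form over `𝔽_p` form a subspace of codimension at
most two. -/
lemma exists_submodule_mem_iff_form_eq_zero {p : ℕ} [hp : Fact p.Prime]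
    (M : Matrix (Fin n) (Fin n) ℤ) (h : ∀ x : Fin n → ZMod p, form M x = 0 → grad M x = 0) :
    ∃ U : Submodule (ZMod p) (Fin n → ZMod p), (∀ x, x ∈ U ↔ form M x = 0) ∧
      n ≤ Module.finrank (ZMod p) U + 2 := by
  let U : Submodule (ZMod p) (Fin n → ZMod p) :=
    { carrier := {x | form M x = 0}
      add_mem' := fun {x y} hx hy => by
        change form M (x + y) = 0
        rw [form_add, show form M x = 0 from hx, show form M y = 0 from hy, h x hx]
        simp
      zero_mem' := form_zero M
      smul_mem' := fun c x hx => by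
        change form M (c • x) = 0
        rw [form_smul, show form M x = 0 from hx, mul_zero] }
  refine ⟨U, fun x => Iff.rfl, ?_⟩
  -- A complement of the zero space contains no non-trivial zero, so its dimension is at most 2.
  obtain ⟨W, hW⟩ := U.exists_isCompl
  have hfin := Submodule.finrank_add_eq_of_isCompl hW
  rw [Module.finrank_fin_fun] at hfin
  by_contra hlt
  obtain ⟨x, hxW, hx0, hx⟩ := exists_ne_zero_form_eq_zero M W (by omega)
  exact hx0 ((Submodule.disjoint_def.mp hW.disjoint) x hx hxW)

/-- Integer coordinates adapted to a subspace modulo `p`. -/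
lemma exists_adapted_matrix {p : ℕ} [hp : Fact p.Prime]
    (U : Submodule (ZMod p) (Fin n → ZMod p)) :
    ∃ (T : Matrix (Fin n) (Fin n) ℤ) (S : Finset (Fin n)),
      S.card + Module.finrank (ZMod p) U = n ∧ ¬ (p : ℤ) ∣ T.det ∧
      ∀ y : Fin n → ℤ, (fun j => (((T *ᵥ y) j : ℤ) : ZMod p)) ∈ U ↔ ∀ i ∈ S, (p : ℤ) ∣ y i := by
  classical
  obtain ⟨W, hW⟩ := U.exists_isCompl
  have hfin := Submodule.finrank_add_eq_of_isCompl hW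
  rw [Module.finrank_fin_fun] at hfin
  set bU := Module.finBasis (ZMod p) U
  set bW := Module.finBasis (ZMod p) W
  let φ : Fin (Module.finrank (ZMod p) U) ⊕ Fin (Module.finrank (ZMod p) W) ≃ Fin n :=
    finSumFinEquiv.trans (finCongr hfin)
  -- The columns of `T` lift a basis adapted to U ⊕ W, and `S` collects the indices belonging to W.
  let b : Module.Basis (Fin n) (ZMod p) (Fin n → ZMod p) :=
    ((bU.prod bW).map (Submodule.prodEquivOfIsCompl U W hW)).reindex φ
  have hb : ∀ i, b (φ (Sum.inl i)) = bU i := by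
    intro i
    simp [b]
  choose T hT using fun j i => ZMod.intCast_surjective (b i j)
  refine ⟨Matrix.of T, Finset.univ.image (fun i => φ (Sum.inr i)), ?_, ?_, ?_⟩
  · rw [Finset.card_image_of_injective _ fun a b h => Sum.inr_injective (φ.injective h)]
    simp only [Finset.card_univ, Fintype.card_fin]
    omega
  · intro hdvd
    have h1 : (((Matrix.of T).det : ℤ) : ZMod p) = 0 := (ZMod.intCast_zmod_eq_zero_iff_dvd _ _).mpr hdvd
    have h2 : (((Matrix.of T).det : ℤ) : ZMod p)
        = ((Pi.basisFun (ZMod p) (Fin n)).toMatrix b).det := by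
      have := (Int.castRingHom (ZMod p)).map_det (Matrix.of T)
      refine Eq.trans this ?_
      congr 1
      ext i j
      simp [Module.Basis.toMatrix_apply, hT]
    rw [h2, ← Module.Basis.det_apply] at h1
    exact ((Pi.basisFun (ZMod p) (Fin n)).isUnit_det b).ne_zero h1
  · intro y
    have hUspan : U = Submodule.span (ZMod p) (b '' (Set.range fun i => φ (Sum.inl i))) := by
      rw [← Set.range_comp]
      have : (b ∘ fun i => φ (Sum.inl i)) = fun i => U.subtype (bU i) := funext hb
      rw [this, Set.range_comp' U.subtype bU, Submodule.span_image, bU.span_eq, Submodule.map_top,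
        Submodule.range_subtype]
    have hTy : (fun j => (((Matrix.of T *ᵥ y) j : ℤ) : ZMod p)) = ∑ i, (y i : ZMod p) • b i := by
      ext j
      simp [Matrix.mulVec, dotProduct, hT, mul_comm]
    rw [hTy]
    conv_lhs => rw [hUspan]
    rw [b.mem_span_image]
    have hrepr : ∀ i, b.repr (∑ i, (y i : ZMod p) • b i) i = (y i : ZMod p) := fun i => by
      rw [b.repr_sum_self]
    constructor
    · intro hs i hi
      obtain ⟨i', -, rfl⟩ := Finset.mem_image.mp hi
      rw [← ZMod.intCast_zmod_eq_zero_iff_dvd, ← hrepr]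
      by_contra hne
      obtain ⟨i'', h3⟩ := hs (Finsupp.mem_support_iff.mpr hne)
      simpa using φ.injective h3
    · intro hs i hi
      have hi' := Finsupp.mem_support_iff.mp hi
      rw [hrepr] at hi'
      obtain ⟨s, rfl⟩ := φ.surjective i
      rcases s with s | s
      · exact ⟨s, rfl⟩
      · exact absurd ((ZMod.intCast_zmod_eq_zero_iff_dvd _ _).mpr
          (hs _ (Finset.mem_image_of_mem _ (Finset.mem_univ s)))) hi'

lemma map_intCast_self (A : Matrix (Fin n) (Fin n) ℤ) : A.map (Int.cast : ℤ → ℤ) = A := by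
  ext; simp

/-- Values at basis vectors and their sums show that p divides the diagonal entries and the cross
coefficients N i j + N j i. These are stored in an upper triangular matrix, since halving the cross
coefficients need not be possible over ℤ. -/
lemma exists_form_div {p : ℤ} (N : Matrix (Fin n) (Fin n) ℤ)
    (hN : ∀ y : Fin n → ℤ, p ∣ form N y) :
    ∃ M' : Matrix (Fin n) (Fin n) ℤ, (∀ y : Fin n → ℤ, p * form M' y = form N y) ∧
      p • (M' + M'ᵀ) = N + Nᵀ := by
  have hdiag : ∀ i, p ∣ N i i := fun i => by
    have := hN (Pi.single i 1)
    simpa [form] using this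
  have hoff : ∀ i j, p ∣ N i j + N j i := fun i j => by
    have h1 := form_add N (Pi.single j 1) (Pi.single i (1 : ℤ))
    have h2 : (Pi.single i (1 : ℤ)) ⬝ᵥ grad N (Pi.single j 1) = N i j + N j i := by
      simp [grad]
    rw [h2] at h1
    have h3 : N i j + N j i = form N (Pi.single j 1 + Pi.single i (1 : ℤ))
      - form N (Pi.single j (1 : ℤ)) - form N (Pi.single i (1 : ℤ)) := by linarith
    rw [h3]
    exact dvd_sub (dvd_sub (hN _) (hN _)) (hN _)
  choose a ha using hdiag
  choose b hb using hoff
  let M' : Matrix (Fin n) (Fin n) ℤ :=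
    Matrix.of fun i j => if i = j then a i else if i < j then b i j else 0
  have hM' : p • (M' + M'ᵀ) = N + Nᵀ := by
    ext i j
    simp only [Matrix.smul_apply, Matrix.add_apply, Matrix.transpose_apply, smul_eq_mul, M',
      Matrix.of_apply]
    rcases lt_trichotomy i j with h | rfl | h
    · rw [if_neg h.ne, if_pos h, if_neg h.ne', if_neg h.not_gt, hb]; ring
    · simp only [if_true]
      have := ha i
      linarith
    · rw [if_neg h.ne', if_neg h.not_gt, if_neg h.ne, if_pos h, add_comm (N i j), hb]; ring
  refine ⟨M', fun y => ?_, hM'⟩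
  have h1 := dotProduct_grad_self N y
  have h2 := dotProduct_grad_self M' y
  have h3 : grad N y = p • grad M' y := by
    simp only [grad, map_intCast_self]
    rw [← hM', Matrix.smul_mulVec]
  rw [h3, dotProduct_smul, h2, smul_eq_mul] at h1
  linarith

lemma form_mulVec (M P : Matrix (Fin n) (Fin n) ℤ) (y : Fin n → ℤ) :
    form (Pᵀ * M * P) y = form M (P *ᵥ y) := by
  simp only [form, map_intCast_self]
  rw [← Matrix.mulVec_mulVec, ← Matrix.mulVec_mulVec, Matrix.dotProduct_mulVec,
    Matrix.vecMul_transpose]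

/-- Weak solubility at a single prime. -/
def WeaklySoluble (k : ℤ) (M : Matrix (Fin n) (Fin n) ℤ) (p : ℕ) : Prop :=
  ∀ t : ℕ, ∃ x : Fin n → ℤ, form M x ≡ k [ZMOD (p : ℤ) ^ t]

/-- By Euler's identity x·∇Q = 2Q, a gradient divisible by p^(1+τ) would force p ∣ Q(x), hence p ∣
k. -/
lemma smoothlySoluble_of_not_dvd {k : ℤ} {M : Matrix (Fin n) (Fin n) ℤ} {p : ℕ} (hp : p.Prime)
    (hw : WeaklySoluble k M p) (hk : ¬ (p : ℤ) ∣ k) : SmoothlySoluble k M p := by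
  obtain ⟨x, hx⟩ := hw (1 + 2 * tau p)
  refine ⟨x, hx, ?_⟩
  by_contra hall
  push Not at hall
  have h1 : (p : ℤ) ^ (1 + tau p) ∣ 2 * form M x := by
    rw [← dotProduct_grad_self]
    exact Finset.dvd_sum fun i _ => (hall i).mul_left _
  have h2 : (p : ℤ) ∣ form M x := by
    by_cases h : p = 2
    · subst h
      simp only [tau, if_true] at h1
      norm_num at h1
      push_cast
      omega
    · simp only [tau, if_neg h, add_zero, pow_one] at h1
      rcases (Nat.prime_iff_prime_int.mp hp).dvd_or_dvd h1 with h3 | h3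
      · exact absurd ((Nat.prime_dvd_prime_iff_eq hp Nat.prime_two).mp (by exact_mod_cast h3)) h
      · exact h3
  exact hk (((hx.of_dvd (dvd_pow_self _ (by omega))).dvd_iff).mp h2)

lemma smoothlySoluble_of_mod_prime {k : ℤ} {M : Matrix (Fin n) (Fin n) ℤ} {p : ℕ} [hp : Fact p.Prime]
    {x : Fin n → ZMod p} (hx : form M x = (k : ZMod p)) (hg : grad M x ≠ 0) :
    SmoothlySoluble k M p := by
  choose y hy using fun j => ZMod.intCast_surjective (x j)
  obtain rfl : x = fun j => (y j : ZMod p) := funext fun j => (hy j).symm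
  obtain ⟨i, hi⟩ := Function.ne_iff.mp hg
  rw [grad_intCast] at hi
  rw [form_intCast, ZMod.intCast_eq_intCast_iff] at hx
  have hi' : ¬ (p : ℤ) ∣ grad M y i := fun h => hi ((ZMod.intCast_zmod_eq_zero_iff_dvd _ _).mpr h)
  obtain ⟨z, hz1, hz2, hz3⟩ := exists_lift_along_coordinate k M hp.out (w := 0) (y := y) (i := i)
    (by simpa using hx) (by simpa using hi') (1 + 2 * tau p)
  refine ⟨z, hz3, i, fun h => hi' ?_⟩
  have hzy : ∀ j, z j ≡ y j [ZMOD p] := fun j => by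
    by_cases hj : j = i
    · subst hj; exact hz2
    · rw [hz1 j hj]
  exact ((grad_modEq M hzy i).dvd_iff).mp ((dvd_pow_self _ (by omega)).trans h)

/-- `T` is invertible modulo p^(t+1), so two points of a fibre differ only in the coordinates in
`S`, each by an element killed by p. -/
lemma card_mulVec_eq_le {p : ℕ} [hp : Fact p.Prime] {T : Matrix (Fin n) (Fin n) ℤ} {S : Finset (Fin n)}
    (hT : ¬ (p : ℤ) ∣ T.det) (t : ℕ) (b : Fin n → ZMod (p ^ (t + 1))) :
    (Finset.univ.filter fun y : Fin n → ZMod (p ^ (t + 1)) =>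
      (T.map Int.cast *ᵥ fun i => if i ∈ S then (p : ZMod (p ^ (t + 1))) * y i else y i) = b).card
      ≤ p ^ S.card := by
  classical
  rcases (Finset.univ.filter fun y : Fin n → ZMod (p ^ (t + 1)) =>
      (T.map Int.cast *ᵥ fun i => if i ∈ S then (p : ZMod (p ^ (t + 1))) * y i else y i) = b).eq_empty_or_nonempty
    with h | ⟨y₀, hy₀⟩
  · rw [h]; simp
  have hunit : IsUnit (T.map (Int.cast : ℤ → ZMod (p ^ (t + 1)))) := by
    rw [Matrix.isUnit_iff_isUnit_det]
    have : ((T.det : ℤ) : ZMod (p ^ (t + 1))) = (T.map (Int.cast : ℤ → ZMod (p ^ (t + 1)))).det :=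
      (Int.castRingHom (ZMod (p ^ (t + 1)))).map_det T
    rw [← this, ZMod.coe_int_isUnit_iff_isCoprime]
    push_cast
    exact IsCoprime.pow_left ((Nat.prime_iff_prime_int.mp hp.out).coprime_iff_not_dvd.mpr hT)
  have hcard : (Fintype.piFinset fun i : Fin n => if i ∈ S then
      Finset.univ.filter fun a : ZMod (p ^ (t + 1)) => (p : ZMod (p ^ (t + 1))) * a = 0
      else {0}).card = p ^ S.card := by
    rw [Fintype.card_piFinset]
    have : ∀ i : Fin n, (if i ∈ S then
      Finset.univ.filter fun a : ZMod (p ^ (t + 1)) => (p : ZMod (p ^ (t + 1))) * a = 0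
      else {0}).card = if i ∈ S then p else 1 := fun i => by
      split_ifs
      · exact card_natCast_mul_eq_zero (p := p) (t := t)
      · simp
    rw [Finset.prod_congr rfl fun i _ => this i, Finset.prod_ite_mem, Finset.univ_inter,
      Finset.prod_const]
  rw [← hcard]
  have hy₀' := (Finset.mem_filter.mp hy₀).2
  refine Finset.card_le_card_of_injOn (fun y => y - y₀) (fun y hy => ?_)
    (fun a _ b _ h => sub_left_inj.mp h)
  have h1 := (Finset.mem_filter.mp hy).2
  have h3 := Matrix.mulVec_injective_of_isUnit hunit (h1.trans hy₀'.symm)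
  refine Fintype.mem_piFinset.mpr fun i => ?_
  have h4 := congrFun h3 i
  split_ifs at h4 ⊢ with hi
  · simp only [Finset.mem_filter, Finset.mem_univ, true_and, Pi.sub_apply]
    rw [mul_sub, h4, sub_self]
  · simp [h4]

/-- Passage to the sublattice of vectors on which the form is divisible by `p`. -/
lemma exists_descent {k : ℤ} {M : Matrix (Fin n) (Fin n) ℤ} {p : ℕ} [hp : Fact p.Prime]
    (hw : WeaklySoluble k M p) (hs : ¬ SmoothlySoluble k M p) :
    ∃ (k' : ℤ) (M' : Matrix (Fin n) (Fin n) ℤ) (s : ℕ) (d : ℤ), s ≤ 2 ∧ ¬ (p : ℤ) ∣ d ∧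
      (p : ℤ) ^ n * (M' + M'ᵀ).det = d ^ 2 * p ^ (2 * s) * (M + Mᵀ).det ∧
      WeaklySoluble k' M' p ∧
      ∀ t, p ^ n * solCount k' M' (p ^ t) ≤ p ^ s * solCount k M (p ^ (t + 1)) := by
  classical
  have hp0 : (p : ℤ) ≠ 0 := by exact_mod_cast hp.out.ne_zero
  have hk : (p : ℤ) ∣ k := by
    by_contra h
    exact hs (smoothlySoluble_of_not_dvd hp.out hw h)
  have hkz : (k : ZMod p) = 0 := (ZMod.intCast_zmod_eq_zero_iff_dvd _ _).mpr hk
  obtain ⟨U, hU, hUn⟩ := exists_submodule_mem_iff_form_eq_zero (p := p) M (fun x hx => by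
    by_contra hg
    exact hs (smoothlySoluble_of_mod_prime (hx.trans hkz.symm) hg))
  obtain ⟨T, S, hS, hTd, hTU⟩ := exists_adapted_matrix U
  obtain ⟨k', rfl⟩ := hk
  set D : Matrix (Fin n) (Fin n) ℤ := Matrix.diagonal fun i => if i ∈ S then (p : ℤ) else 1 with hD
  set P := T * D with hP
  have hDy : ∀ y : Fin n → ℤ, D *ᵥ y = fun i => if i ∈ S then (p : ℤ) * y i else y i := fun y => by
    ext i
    rw [hD, Matrix.mulVec_diagonal]
    split_ifs <;> simp
  have hdiv : ∀ y : Fin n → ℤ, (p : ℤ) ∣ form (Pᵀ * M * P) y := by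
    intro y
    rw [form_mulVec, ← ZMod.intCast_zmod_eq_zero_iff_dvd, ← form_intCast, ← hU, hP,
      ← Matrix.mulVec_mulVec, hTU]
    intro i hi
    rw [hDy]
    simp [hi]
  obtain ⟨M', hM', hM'B⟩ := exists_form_div _ hdiv
  refine ⟨k', M', S.card, T.det, by omega, hTd, ?_, ?_, ?_⟩
  · have h1 : (Pᵀ * M * P) + (Pᵀ * M * P)ᵀ = Pᵀ * (M + Mᵀ) * P := by
      simp only [Matrix.transpose_mul, Matrix.transpose_transpose, Matrix.mul_add, Matrix.add_mul,
        Matrix.mul_assoc]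
    have h2 := congrArg Matrix.det hM'B
    rw [Matrix.det_smul, Fintype.card_fin, h1, Matrix.det_mul, Matrix.det_mul, Matrix.det_transpose]
      at h2
    have h3 : P.det = T.det * p ^ S.card := by
      rw [hP, Matrix.det_mul, hD, Matrix.det_diagonal, Finset.prod_ite_mem, Finset.univ_inter,
        Finset.prod_const]
    rw [h2, h3]; ring
  · intro t
    obtain ⟨x, hx⟩ := hw (t + 1)
    -- Here v inverts det T modulo p^(t+1), so that v · adj(T) inverts T there.
    obtain ⟨u, v, huv⟩ : IsCoprime ((p : ℤ) ^ (t + 1)) T.det :=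
      IsCoprime.pow_left ((Nat.prime_iff_prime_int.mp hp.out).coprime_iff_not_dvd.mpr hTd)
    set y₀ := v • (T.adjugate *ᵥ x) with hy₀
    have hTy : ∀ i, (T *ᵥ y₀) i ≡ x i [ZMOD (p : ℤ) ^ (t + 1)] := by
      intro i
      have : T *ᵥ y₀ = (v * T.det) • x := by
        rw [hy₀, Matrix.mulVec_smul, Matrix.mulVec_mulVec, Matrix.mul_adjugate, Matrix.smul_mulVec,
          Matrix.one_mulVec, smul_smul]
      rw [this, Pi.smul_apply, smul_eq_mul, Int.modEq_iff_dvd]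
      exact ⟨u * x i, by linear_combination (x i) * (-huv)⟩
    have hform : form M (T *ᵥ y₀) ≡ p * k' [ZMOD (p : ℤ) ^ (t + 1)] := (form_modEq M hTy).trans hx
    -- Since p ∣ k, a solution is a zero of Q modulo p and so lies in the sublattice.
    have hmem := (hTU y₀).mp (by
      rw [hU, form_intCast, ZMod.intCast_zmod_eq_zero_iff_dvd]
      exact ((hform.of_dvd (dvd_pow_self _ (by omega))).dvd_iff).mpr (dvd_mul_right _ _))
    have hex : ∀ i, ∃ z : ℤ, (if i ∈ S then (p : ℤ) * z else z) = y₀ i := fun i => by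
      by_cases hi : i ∈ S
      · obtain ⟨z, hz⟩ := hmem i hi
        exact ⟨z, by rw [if_pos hi, hz]⟩
      · exact ⟨y₀ i, by rw [if_neg hi]⟩
    choose y hy using hex
    refine ⟨y, ?_⟩
    have h1 : (p : ℤ) * form M' y ≡ p * k' [ZMOD (p : ℤ) ^ (t + 1)] := by
      rw [hM', form_mulVec, hP, ← Matrix.mulVec_mulVec, hDy, funext hy]
      exact hform
    rw [pow_succ'] at h1
    exact Int.ModEq.mul_left_cancel' hp0 h1
  · intro t
    set V := Finset.univ.filter fun y : Fin n → ZMod (p ^ (t + 1)) =>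
      form M' (reduction n (pow_dvd_pow p t.le_succ) y) = ((k' : ℤ) : ZMod (p ^ t)) with hV
    have hVc : V.card = p ^ n * solCount k' M' (p ^ t) := by
      rw [solCount_eq_card]
      exact card_filter_reduction (p := p) (t := t) fun x => form M' x = ((k' : ℤ) : ZMod (p ^ t))
    rw [← hVc, solCount_eq_card]
    -- Solutions of the descended congruence, viewed modulo p^(t+1), map to solutions of the
    -- original one with fibres of size at most p^s.
    refine Finset.card_le_mul_card_image_of_maps_to (f := fun y : Fin n → ZMod (p ^ (t + 1)) =>
      T.map Int.cast *ᵥ fun i => if i ∈ S then (p : ZMod (p ^ (t + 1))) * y i else y i) ?_ _ ?_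
    · intro y hy
      have hy' := (Finset.mem_filter.mp (Finset.mem_coe.mp hy)).2
      choose z hz using fun j => ZMod.intCast_surjective (y j)
      obtain rfl : y = fun j => (z j : ZMod (p ^ (t + 1))) := funext fun j => (hz j).symm
      have h1 : (T.map (Int.cast : ℤ → ZMod (p ^ (t + 1))) *ᵥ fun i =>
          if i ∈ S then (p : ZMod (p ^ (t + 1))) * z i else z i)
          = fun j => (((P *ᵥ z) j : ℤ) : ZMod (p ^ (t + 1))) := by
        ext j
        rw [hP, ← Matrix.mulVec_mulVec, hDy, ← eq_intCast (Int.castRingHom (ZMod (p ^ (t + 1)))),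
          RingHom.map_mulVec]
        congr 1
        ext i
        simp only [Function.comp_apply]
        split_ifs <;> simp
      refine Finset.mem_filter.mpr ⟨Finset.mem_univ _, ?_⟩
      rw [h1, form_intCast, ← form_mulVec, ← hM']
      rw [form_reduction, form_intCast, map_intCast, ZMod.intCast_eq_intCast_iff] at hy'
      rw [ZMod.intCast_eq_intCast_iff]
      push_cast at hy' ⊢
      rw [pow_succ']
      exact Int.ModEq.mul_left' hy'
    · intro b _
      refine (Finset.card_le_card ?_).trans (card_mulVec_eq_le (S := S) hTd t b)
      exact Finset.filter_subset_filter _ (Finset.subset_univ _)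

/-- The local density of a weakly soluble form, by descent. -/
theorem exists_smoothBound_div_pow_le_sigma {p : ℕ} (hp : p.Prime) (hn : 5 ≤ n) (k : ℤ)
    (M : Matrix (Fin n) (Fin n) ℤ) (hM : (M + Mᵀ).det ≠ 0) (hw : WeaklySoluble k M p) :
    ∃ m : ℕ, m * (n - 4) ≤ padicValInt p (M + Mᵀ).det ∧ smoothBound n / p ^ m ≤ sigma k M p := by
  have := Fact.mk hp
  have hp0 : (0 : ℝ) < p := by exact_mod_cast hp.pos
  have hp1 : (1 : ℝ) ≤ p := by exact_mod_cast hp.one_lt.le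
  induction hv : padicValInt p (M + Mᵀ).det using Nat.strong_induction_on generalizing k M with
  | _ v ih =>
  by_cases hs : SmoothlySoluble k M p
  · exact ⟨0, by simp, by simpa using smoothBound_le_sigma k M hp (by omega) hM hs⟩
  obtain ⟨k', M', s, d, hs2, hd, hdet, hw', hcount⟩ := exists_descent hw hs
  have hpz : (p : ℤ) ≠ 0 := by exact_mod_cast hp.ne_zero
  have hd0 : d ≠ 0 := by rintro rfl; exact hd (dvd_zero _)
  have hM' : (M' + M'ᵀ).det ≠ 0 := by
    intro h
    rw [h, mul_zero] at hdet
    exact (mul_ne_zero (mul_ne_zero (pow_ne_zero _ hd0) (pow_ne_zero _ hpz)) hM) hdet.symm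
  -- The valuation falls by n - 2s ≥ n - 4 ≥ 1, so the induction terminates.
  have hval : n + padicValInt p (M' + M'ᵀ).det = 2 * s + v := by
    have h := congrArg (padicValInt p) hdet
    rw [padicValInt.mul (pow_ne_zero _ hpz) hM', padicValInt.mul
      (mul_ne_zero (pow_ne_zero _ hd0) (pow_ne_zero _ hpz)) hM, padicValInt.mul
      (pow_ne_zero _ hd0) (pow_ne_zero _ hpz), hv, sq, padicValInt.mul hd0 hd0,
      padicValInt.eq_zero_of_not_dvd hd] at h
    have hpow : ∀ j, padicValInt p ((p : ℤ) ^ j) = j := fun j => by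
      rw [padicValInt, Int.natAbs_pow, Int.natAbs_natCast, padicValNat.prime_pow]
    rw [hpow, hpow] at h
    omega
  obtain ⟨m, hm1, hm2⟩ := ih _ (by omega) k' M' hM' hw' rfl
  have hlim : p * sigma k' M' p ≤ p ^ s * sigma k M p := by
    have h1 := (tendsto_densitySeq k' M' hp (by omega) hM').const_mul (p : ℝ)
    have h2 := ((tendsto_add_atTop_iff_nat 1).mpr
      (tendsto_densitySeq k M hp (by omega) hM)).const_mul ((p : ℝ) ^ s)
    refine le_of_tendsto_of_tendsto' h1 h2 fun t => ?_
    have h3 : (p : ℝ) ^ n * solCount k' M' (p ^ t) ≤ p ^ s * solCount k M (p ^ (t + 1)) := by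
      exact_mod_cast hcount t
    rw [densitySeq, densitySeq, mul_div_assoc', mul_div_assoc', div_le_div_iff₀ (by positivity)
      (by positivity)]
    obtain ⟨l, rfl⟩ := Nat.exists_eq_add_of_le' (show 1 ≤ n by omega)
    rw [Nat.add_sub_cancel, add_mul, one_mul, pow_add _ (t * l)]
    rw [pow_succ] at h3
    have := mul_le_mul_of_nonneg_right h3 (pow_nonneg hp0.le (t * l))
    linarith
  have hσ' : 0 ≤ sigma k' M' p := le_trans (by have := smoothBound_pos n; positivity) hm2
  -- For s ≤ 1 the density loses nothing; for s = 2 it loses one factor p, paid for by the drop n -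
  -- 4.
  rcases (show s ≤ 1 ∨ s = 2 by omega) with h1 | rfl
  · refine ⟨m, by omega, hm2.trans ?_⟩
    have h2 : (p : ℝ) ^ s ≤ p := by
      calc (p : ℝ) ^ s ≤ p ^ 1 := pow_le_pow_right₀ hp1 h1
        _ = p := pow_one _
    have h3 : 0 ≤ sigma k M p := by
      by_contra hneg
      push Not at hneg
      have := mul_neg_of_pos_of_neg (pow_pos hp0 s) hneg
      have := mul_nonneg hp0.le hσ'
      linarith
    exact le_of_mul_le_mul_left (hlim.trans (mul_le_mul_of_nonneg_right h2 h3)) hp0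
  · refine ⟨m + 1, ?_, ?_⟩
    · rw [add_mul, one_mul]; omega
    · have h3 : sigma k' M' p ≤ p * sigma k M p := by
        rw [sq, mul_assoc] at hlim
        exact le_of_mul_le_mul_left hlim hp0
      rw [pow_succ, ← div_div, div_le_iff₀ hp0]
      linarith

/-! ### Strong solubility for symmetric matrices. -/

lemma add_transpose_of_isSymm {A : Matrix (Fin n) (Fin n) ℤ} (hA : A.IsSymm) :
    A + Aᵀ = (2 : ℤ) • A := by
  rw [hA.eq, two_smul]

lemma det_add_transpose {A : Matrix (Fin n) (Fin n) ℤ} (hA : A.IsSymm) :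
    (A + Aᵀ).det = 2 ^ n * A.det := by
  rw [add_transpose_of_isSymm hA, Matrix.det_smul, Fintype.card_fin]

lemma StrongLSC.smoothlySoluble {k : ℤ} {A : Matrix (Fin n) (Fin n) ℤ} (hA : A.IsSymm)
    (h : StrongLSC k A) {p : ℕ} (hp : p.Prime) : SmoothlySoluble k A p := by
  obtain ⟨x, hx, i, hi⟩ := h p hp
  refine ⟨x, hx, i, fun hdvd => hi ?_⟩
  have h1 : grad A x i = 2 * (A *ᵥ x) i := by
    rw [grad, map_intCast_self, add_transpose_of_isSymm hA, Matrix.smul_mulVec, Pi.smul_apply,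
      smul_eq_mul]
  rw [h1] at hdvd
  by_cases h2 : p = 2
  · subst h2
    simp only [tau, if_true] at hdvd
    norm_num at hdvd
    push_cast
    omega
  · simp only [tau, if_neg h2, add_zero, pow_one] at hdvd
    rcases (Nat.prime_iff_prime_int.mp hp).dvd_or_dvd hdvd with h3 | h3
    · exact absurd ((Nat.prime_dvd_prime_iff_eq hp Nat.prime_two).mp (by exact_mod_cast h3)) h2
    · exact h3

/-! ### Products over all primes. -/

lemma deviation_nonneg (p : ℕ) : 0 ≤ deviation p := by unfold deviation; positivity

lemma summable_deviation : Summable fun p : Nat.Primes => deviation p := by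
  have h := (Nat.Primes.summable_rpow (r := -(3 / 2))).mpr (by norm_num)
  refine h.congr fun p => ?_
  rw [deviation, Real.sqrt_eq_rpow, ← Real.rpow_neg (by positivity), ← Real.rpow_natCast,
    ← Real.rpow_mul (by positivity)]
  norm_num

lemma deviation_le {p : ℕ} (hp : 5 ≤ p) : deviation p ≤ 1 / 8 := by
  have h1 : (2 : ℝ) ≤ √(p : ℝ) := Real.le_sqrt_of_sq_le (by
    have : (5 : ℝ) ≤ p := by exact_mod_cast hp
    linarith)
  calc deviation p ≤ (2⁻¹ : ℝ) ^ 3 := by unfold deviation; gcongr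
    _ = 1 / 8 := by norm_num

/-- The primes dividing `N`, as a finite set of elements of `Nat.Primes`. -/
def badPrimes (N : ℕ) : Finset Nat.Primes := N.primeFactors.subtype Nat.Prime

lemma mem_badPrimes {N : ℕ} (hN : N ≠ 0) (p : Nat.Primes) : p ∈ badPrimes N ↔ (p : ℕ) ∣ N :=
  Finset.mem_subtype.trans ⟨fun h => Nat.dvd_of_mem_primeFactors h,
    fun h => Nat.mem_primeFactors.mpr ⟨p.2, h, hN⟩⟩

lemma prod_badPrimes (N : ℕ) (f : ℕ → ℝ) :
    ∏ p ∈ badPrimes N, f p = ∏ p ∈ N.primeFactors, f p :=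
  Finset.prod_subtype_of_mem f fun _ hp => Nat.prime_of_mem_primeFactors hp

lemma multipliable_of_abs_sub_one_le {s : ℕ → ℝ} {N : ℕ} (hN : N ≠ 0)
    (hs : ∀ p : ℕ, p.Prime → ¬ p ∣ N → |s p - 1| ≤ 4 * deviation p) :
    Multipliable fun p : Nat.Primes => s p := by
  have h : Summable fun p : Nat.Primes => s p - 1 := by
    refine Summable.of_norm_bounded_eventually (summable_deviation.mul_left 4) ?_
    rw [Filter.eventually_cofinite]
    refine (badPrimes N).finite_toSet.subset fun p hp => ?_
    rw [Finset.mem_coe, mem_badPrimes hN]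
    by_contra hdvd
    exact hp (hs p p.2 hdvd)
  have := Real.multipliable_one_add_of_summable h
  simpa using this

lemma exp_neg_two_mul_le {x : ℝ} (h0 : 0 ≤ x) (h1 : x ≤ 1 / 2) : Real.exp (-(2 * x)) ≤ 1 - x := by
  have h2 := Real.add_one_le_exp (2 * x)
  rw [Real.exp_neg, inv_le_iff_one_le_mul₀ (Real.exp_pos _)]
  nlinarith

/-- A constant raised to the number of prime factors is at least a small negative power. -/
lemma exists_mul_rpow_le_pow_card_primeFactors {c ε : ℝ} (hc : 0 < c) (hc1 : c ≤ 1) (hε : 0 < ε) :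
    ∃ C : ℝ, 0 < C ∧ ∀ N : ℕ, N ≠ 0 → C * (N : ℝ) ^ (-ε) ≤ c ^ N.primeFactors.card := by
  -- Beyond c^(-1/ε) one has p^(-ε) ≤ c; the fewer than P + 1 smaller primes are absorbed into c^P.
  obtain ⟨P, hP⟩ := exists_nat_ge (c⁻¹ ^ (1 / ε))
  refine ⟨c ^ P, by positivity, fun N hN => ?_⟩
  have hterm : ∀ p ∈ N.primeFactors, (if p < P then c else 1) * (p : ℝ) ^ (-ε) ≤ c := by
    intro p hp
    have hp1 : (1 : ℝ) ≤ p := by exact_mod_cast (Nat.prime_of_mem_primeFactors hp).one_lt.le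
    split_ifs with h
    · have := Real.rpow_le_one_of_one_le_of_nonpos hp1 (neg_nonpos.mpr hε.le)
      nlinarith
    · push Not at h
      have h1 : c⁻¹ ^ (1 / ε) ≤ p := hP.trans (by exact_mod_cast h)
      have h2 := Real.rpow_le_rpow (by positivity) h1 hε.le
      rw [← Real.rpow_mul (by positivity), one_div, inv_mul_cancel₀ hε.ne', Real.rpow_one] at h2
      rw [one_mul, Real.rpow_neg (by positivity)]
      exact inv_le_of_inv_le₀ hc h2
  have hprod : ∏ p ∈ N.primeFactors, ((if p < P then c else 1) * (p : ℝ) ^ (-ε))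
      ≤ c ^ N.primeFactors.card := by
    rw [← Finset.prod_const]
    exact Finset.prod_le_prod (fun p _ => mul_nonneg (by split_ifs <;> linarith) (by positivity)) hterm
  refine le_trans ?_ hprod
  rw [Finset.prod_mul_distrib]
  have h1 : c ^ P ≤ ∏ p ∈ N.primeFactors, (if p < P then c else 1) := by
    rw [Finset.prod_ite, Finset.prod_const, Finset.prod_const_one, mul_one]
    refine pow_le_pow_of_le_one hc.le hc1 ?_
    calc (N.primeFactors.filter fun p => p < P).card ≤ (Finset.range P).card :=
          Finset.card_le_card fun p hp => Finset.mem_range.mpr (Finset.mem_filter.mp hp).2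
      _ = P := Finset.card_range P
  have h2 : (N : ℝ) ^ (-ε) ≤ ∏ p ∈ N.primeFactors, (p : ℝ) ^ (-ε) := by
    rw [Real.finsetProd_rpow _ _ fun p _ => by positivity]
    have h3 : ∏ p ∈ N.primeFactors, (p : ℝ) ≤ N := by
      rw [← Nat.cast_prod]
      exact_mod_cast Nat.le_of_dvd (Nat.pos_of_ne_zero hN) (Nat.prod_primeFactors_dvd N)
    refine Real.rpow_le_rpow_of_nonpos ?_ h3 (neg_nonpos.mpr hε.le)
    exact Finset.prod_pos fun p hp => by exact_mod_cast (Nat.prime_of_mem_primeFactors hp).pos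
  exact mul_le_mul h1 h2 (by positivity) (Finset.prod_nonneg fun p _ => by split_ifs <;> linarith)

/-- A product over the primes whose factors are close to `1` away from the divisors of `N`. -/
lemma exists_mul_rpow_div_le_tprod {c ε : ℝ} (hc : 0 < c) (hc1 : c ≤ 1) (hε : 0 < ε) :
    ∃ C : ℝ, 0 < C ∧ ∀ (N : ℕ) (s : ℕ → ℝ) (m : ℕ → ℕ), N ≠ 0 → 6 ∣ N →
      (∀ p : ℕ, p.Prime → ¬ p ∣ N → |s p - 1| ≤ 4 * deviation p) →
      (∀ p : ℕ, p.Prime → c / p ^ m p ≤ s p) →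
      C * (N : ℝ) ^ (-ε) / ∏ p ∈ N.primeFactors, (p : ℝ) ^ m p ≤ ∏' p : Nat.Primes, s p := by
  classical
  obtain ⟨C, hC, hCN⟩ := exists_mul_rpow_le_pow_card_primeFactors hc hc1 hε
  set E := Real.exp (-(8 * ∑' p : Nat.Primes, deviation p)) with hE
  refine ⟨E * C, by positivity, fun N s m hN h6 hgood hbad => ?_⟩
  have hprod := (multipliable_of_abs_sub_one_le hN hgood).hasProd
  refine ge_of_tendsto hprod ?_
  filter_upwards [eventually_ge_atTop (badPrimes N)] with F hF
  have hlow : ∀ p : Nat.Primes, (if p ∈ badPrimes N then c / (p : ℝ) ^ m p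
      else Real.exp (-(8 * deviation p))) ≤ s p := by
    intro p
    split_ifs with h
    · exact hbad p p.2
    · rw [mem_badPrimes hN] at h
      have h1 := (abs_le.mp (hgood p p.2 h)).1
      -- The condition 6 ∣ N leaves only p ≥ 5 as good primes, where 4p^(-3/2) ≤ 1/2 and so 1 - x ≥
      -- exp(-2x) applies.
      have hp5 : 5 ≤ (p : ℕ) := by
        by_contra hlt
        have h2 := p.2.two_le
        apply h
        have h4 : (p : ℕ) = 2 ∨ (p : ℕ) = 3 := by
          have : (p : ℕ) ≠ 4 := fun h4 => by have := p.2; rw [h4] at this; norm_num at this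
          omega
        rcases h4 with h4 | h4 <;> rw [h4] <;> omega
      have h2 := exp_neg_two_mul_le (x := 4 * deviation p) (by linarith [deviation_nonneg p])
        (by linarith [deviation_le hp5])
      rw [← mul_assoc] at h2
      norm_num at h2
      linarith
  have hle := Finset.prod_le_prod (s := F) (fun p _ => by
    split_ifs
    · positivity
    · exact (Real.exp_pos _).le) fun p _ => hlow p
  refine le_trans ?_ hle
  rw [Finset.prod_ite]
  have hfilter : F.filter (fun p => p ∈ badPrimes N) = badPrimes N := by
    ext p
    rw [Finset.mem_filter]
    exact ⟨fun h => h.2, fun h => ⟨hF h, h⟩⟩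
  rw [hfilter, prod_badPrimes N fun p => c / (p : ℝ) ^ m p, Finset.prod_div_distrib, Finset.prod_const,
    ← Real.exp_sum, mul_comm (_ / _), mul_assoc, mul_div_assoc]
  refine mul_le_mul ?_ ?_ (by positivity) (Real.exp_pos _).le
  · rw [hE, Real.exp_le_exp, Finset.sum_neg_distrib, neg_le_neg_iff, ← Finset.mul_sum]
    exact mul_le_mul_of_nonneg_left
      (summable_deviation.sum_le_tsum _ fun p _ => deviation_nonneg p) (by norm_num)
  · exact div_le_div_of_nonneg_right (hCN N hN) (Finset.prod_nonneg fun p _ => by positivity)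

lemma prod_pow_padicValInt {N : ℕ} (hN : N ≠ 0) {D : ℤ} (hD : D ≠ 0) (hDN : D.natAbs ∣ N) :
    ∏ p ∈ N.primeFactors, p ^ padicValInt p D = D.natAbs := by
  have hD' : D.natAbs ≠ 0 := Int.natAbs_ne_zero.mpr hD
  conv_rhs => rw [← Nat.prod_factorization_pow_eq_self hD']
  rw [Finsupp.prod_of_support_subset (s := N.primeFactors) _ (by
    rw [Nat.support_factorization]; exact Nat.primeFactors_mono hDN hN) _ (by simp)]
  refine Finset.prod_congr rfl fun p hp => ?_
  rw [Nat.factorization_def _ (Nat.prime_of_mem_primeFactors hp)]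
  rfl

/-- The r-th power of the product is at most ∏ p^(v_p(D)) = |D|; this is the source of the exponent
1/(n-4). -/
lemma prod_pow_le_rpow {N : ℕ} (hN : N ≠ 0) {D : ℤ} (hD : D ≠ 0) (hDN : D.natAbs ∣ N) {r : ℕ}
    (hr : 0 < r) {m : ℕ → ℕ} (hm : ∀ p : ℕ, p.Prime → m p * r ≤ padicValInt p D) :
    ∏ p ∈ N.primeFactors, (p : ℝ) ^ m p ≤ (D.natAbs : ℝ) ^ (1 / (r : ℝ)) := by
  have h1 : (∏ p ∈ N.primeFactors, p ^ m p) ^ r ≤ D.natAbs := by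
    rw [← prod_pow_padicValInt hN hD hDN, ← Finset.prod_pow]
    refine Finset.prod_le_prod' fun p hp => ?_
    have hp' := Nat.prime_of_mem_primeFactors hp
    rw [← pow_mul]
    exact Nat.pow_le_pow_right hp'.pos (hm p hp')
  have h2 : (∏ p ∈ N.primeFactors, (p : ℝ) ^ m p) ^ r ≤ (D.natAbs : ℝ) := by exact_mod_cast h1
  rw [one_div]
  exact (Real.le_rpow_inv_iff_of_pos (Finset.prod_nonneg fun p _ => by positivity) (by positivity)
    (by exact_mod_cast hr)).mpr (by rwa [Real.rpow_natCast])

lemma smoothBound_le_one (n : ℕ) : smoothBound n ≤ 1 :=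
  inv_le_one_of_one_le₀ (one_le_pow₀ (by norm_num))

lemma natAbs_cast_eq (D : ℤ) : ((D.natAbs : ℕ) : ℝ) = |(D : ℝ)| := by
  rw [Nat.cast_natAbs, Int.cast_abs]

lemma not_dvd_of_not_dvd_natAbs {p N : ℕ} {D : ℤ} (hDN : D.natAbs ∣ N) (h : ¬ p ∣ N) :
    ¬ (p : ℤ) ∣ D := fun hd => h ((Int.natCast_dvd.mp hd).trans hDN)

/-! ### The bounds for the singular series. -/

theorem singularSeries_bound_of_five_le (hn : 5 ≤ n) {ε : ℝ} (hε : 0 < ε) :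
    ∃ c : ℝ, 0 < c ∧ ∀ (A : Matrix (Fin n) (Fin n) ℤ) (k : ℤ), A.IsSymm → A.det ≠ 0 →
      WeakLSC k A → SingularSeriesConverges k A ∧
        c * |(A.det : ℝ)| ^ (-theta k A - ε) ≤ singularSeries k A := by
  obtain ⟨C, hC, hbound⟩ := exists_mul_rpow_div_le_tprod (smoothBound_pos n) (smoothBound_le_one n) hε
  set θ : ℝ := 1 / ((n : ℝ) - 4) with hθ
  have hn4 : (0 : ℝ) < (n : ℝ) - 4 := by
    have : (5 : ℝ) ≤ n := by exact_mod_cast hn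
    linarith
  have hθ0 : 0 < θ := by positivity
  -- The powers of 2^n come from D = det(2A) = 2^n Δ, once in N = 6|D| and once in the descent loss
  -- |D|^θ.
  refine ⟨C * (6 * 2 ^ n : ℝ) ^ (-ε) * ((2 : ℝ) ^ n) ^ (-θ), by positivity,
    fun A k hA hdet hw => ?_⟩
  set D := (A + Aᵀ).det with hD
  have hD0 : D ≠ 0 := by
    rw [hD, det_add_transpose hA]
    exact mul_ne_zero (by positivity) hdet
  have hDabs : (D.natAbs : ℝ) = 2 ^ n * |(A.det : ℝ)| := by
    rw [natAbs_cast_eq, hD, det_add_transpose hA]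
    push_cast
    rw [abs_mul, abs_of_pos (by positivity)]
  have hN : 6 * D.natAbs ≠ 0 := mul_ne_zero (by norm_num) (Int.natAbs_ne_zero.mpr hD0)
  have hgood : ∀ p : ℕ, p.Prime → ¬ p ∣ 6 * D.natAbs → |sigma k A p - 1| ≤ 4 * deviation p :=
    fun p hp hpN => abs_sigma_sub_one_le k A hp hn
      (not_dvd_of_not_dvd_natAbs (dvd_mul_left _ _) hpN)
  refine ⟨⟨fun p hp => tendsto_densitySeq k A hp (by omega) hD0,
    multipliable_of_abs_sub_one_le hN hgood⟩, ?_⟩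
  have hdet1 : 0 < |(A.det : ℝ)| := abs_pos.mpr (by exact_mod_cast hdet)
  have hNcast : ((6 * D.natAbs : ℕ) : ℝ) ^ (-ε) = (6 * 2 ^ n : ℝ) ^ (-ε) * |(A.det : ℝ)| ^ (-ε) := by
    rw [← Real.mul_rpow (by positivity) (by positivity), Nat.cast_mul, hDabs]
    norm_num [mul_assoc]
  by_cases hs : StrongLSC k A
  · have h := hbound _ (sigma k A) (fun _ => 0) hN (dvd_mul_right _ _) hgood fun p hp => by
      simpa using smoothBound_le_sigma k A hp (by omega) hD0 (hs.smoothlySoluble hA hp)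
    simp only [pow_zero, Finset.prod_const_one, div_one] at h
    rw [theta, if_pos hs, neg_zero, zero_sub]
    refine le_trans ?_ h
    rw [hNcast]
    have h2 : ((2 : ℝ) ^ n) ^ (-θ) ≤ 1 :=
      Real.rpow_le_one_of_one_le_of_nonpos (one_le_pow₀ (by norm_num)) (by linarith)
    calc _ = C * ((6 * 2 ^ n : ℝ) ^ (-ε) * |(A.det : ℝ)| ^ (-ε)) * ((2 : ℝ) ^ n) ^ (-θ) := by ring
      _ ≤ C * ((6 * 2 ^ n : ℝ) ^ (-ε) * |(A.det : ℝ)| ^ (-ε)) * 1 := by gcongr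
      _ = _ := by ring
  · have hloc : ∀ p : ℕ, ∃ m : ℕ, p.Prime →
        m * (n - 4) ≤ padicValInt p D ∧ smoothBound n / p ^ m ≤ sigma k A p := by
      intro p
      by_cases hp : p.Prime
      · obtain ⟨m, hm⟩ := exists_smoothBound_div_pow_le_sigma hp hn k A hD0 (hw p hp)
        exact ⟨m, fun _ => hm⟩
      · exact ⟨0, fun h => absurd h hp⟩
    choose m hm using hloc
    have h := hbound _ (sigma k A) m hN (dvd_mul_right _ _) hgood fun p hp => (hm p hp).2
    have h2 := prod_pow_le_rpow hN hD0 (dvd_mul_left _ _) (r := n - 4) (by omega)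
      fun p hp => (hm p hp).1
    rw [theta, if_neg hs]
    refine le_trans ?_ h
    have h3 : (1 : ℝ) / ((n - 4 : ℕ) : ℝ) = θ := by
      rw [hθ, Nat.cast_sub (by omega)]; norm_num
    rw [h3] at h2
    have hpos : 0 < ∏ p ∈ (6 * D.natAbs).primeFactors, (p : ℝ) ^ m p :=
      Finset.prod_pos fun p hp => by
        have := (Nat.prime_of_mem_primeFactors hp).pos
        positivity
    rw [hNcast, le_div_iff₀ hpos]
    have h4 : |(A.det : ℝ)| ^ (-θ - ε) = |(A.det : ℝ)| ^ (-θ) * |(A.det : ℝ)| ^ (-ε) := by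
      rw [← Real.rpow_add hdet1]; ring_nf
    have h5 : ((2 : ℝ) ^ n) ^ (-θ) * |(A.det : ℝ)| ^ (-θ) * (D.natAbs : ℝ) ^ θ = 1 := by
      rw [← Real.mul_rpow (by positivity) hdet1.le, ← hDabs, ← Real.rpow_add]
      · simp
      · rw [hDabs]; positivity
    calc C * (6 * 2 ^ n : ℝ) ^ (-ε) * ((2 : ℝ) ^ n) ^ (-θ) * |(A.det : ℝ)| ^ (-θ - ε)
          * ∏ p ∈ (6 * D.natAbs).primeFactors, (p : ℝ) ^ m p
        ≤ C * (6 * 2 ^ n : ℝ) ^ (-ε) * ((2 : ℝ) ^ n) ^ (-θ) * |(A.det : ℝ)| ^ (-θ - ε)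
          * (D.natAbs : ℝ) ^ θ := by gcongr
      _ = C * ((6 * 2 ^ n : ℝ) ^ (-ε) * |(A.det : ℝ)| ^ (-ε)) *
          (((2 : ℝ) ^ n) ^ (-θ) * |(A.det : ℝ)| ^ (-θ) * (D.natAbs : ℝ) ^ θ) := by rw [h4]; ring
      _ = _ := by rw [h5, mul_one]

theorem singularSeries_bound_of_four {ε : ℝ} (hε : 0 < ε) :
    ∃ c : ℝ, 0 < c ∧ ∀ (A : Matrix (Fin 4) (Fin 4) ℤ) (k : ℤ), A.IsSymm → A.det ≠ 0 → 0 < k →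
      StrongLSC k A → SingularSeriesConverges k A ∧
        c * ((k : ℝ) ^ (-ε) * |(A.det : ℝ)| ^ (-ε)) ≤ singularSeries k A := by
  obtain ⟨C, hC, hbound⟩ := exists_mul_rpow_div_le_tprod (smoothBound_pos 4) (smoothBound_le_one 4) hε
  refine ⟨C * (96 : ℝ) ^ (-ε), by positivity, fun A k hA hdet hk hs => ?_⟩
  set D := (A + Aᵀ).det with hD
  have hD0 : D ≠ 0 := by
    rw [hD, det_add_transpose hA]
    exact mul_ne_zero (by positivity) hdet
  have hDabs : (D.natAbs : ℝ) = 2 ^ 4 * |(A.det : ℝ)| := by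
    rw [natAbs_cast_eq, hD, det_add_transpose hA]
    rw [Int.cast_mul, abs_mul, Int.cast_pow, Int.cast_ofNat, abs_of_pos (by positivity)]
  have hkR : (0 : ℝ) < k := by exact_mod_cast hk
  -- For n = 4 the primes dividing k also count as bad, whence the factor k^(-ε).
  have hN : 6 * (D.natAbs * k.natAbs) ≠ 0 := mul_ne_zero (by norm_num)
    (mul_ne_zero (Int.natAbs_ne_zero.mpr hD0) (Int.natAbs_ne_zero.mpr hk.ne'))
  have hgood : ∀ p : ℕ, p.Prime → ¬ p ∣ 6 * (D.natAbs * k.natAbs) →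
      |sigma k A p - 1| ≤ 4 * deviation p := fun p hp hpN =>
    abs_sigma_sub_one_le_of_four k A hp
      (not_dvd_of_not_dvd_natAbs ((dvd_mul_right _ _).trans (dvd_mul_left _ _)) hpN)
      (not_dvd_of_not_dvd_natAbs ((dvd_mul_left _ _).trans (dvd_mul_left _ _)) hpN)
  refine ⟨⟨fun p hp => tendsto_densitySeq k A hp le_rfl hD0,
    multipliable_of_abs_sub_one_le hN hgood⟩, ?_⟩
  have h := hbound _ (sigma k A) (fun _ => 0) hN (dvd_mul_right _ _) hgood fun p hp => by
    simpa using smoothBound_le_sigma k A hp le_rfl hD0 (hs.smoothlySoluble hA hp)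
  simp only [pow_zero, Finset.prod_const_one, div_one] at h
  refine le_trans (le_of_eq ?_) h
  have hNcast : ((6 * (D.natAbs * k.natAbs) : ℕ) : ℝ) = 96 * (k * |(A.det : ℝ)|) := by
    rw [Nat.cast_mul, Nat.cast_mul, hDabs, natAbs_cast_eq, abs_of_pos hkR]
    push_cast
    ring
  rw [hNcast, Real.mul_rpow (by norm_num) (by positivity), Real.mul_rpow hkR.le (abs_nonneg _),
    mul_assoc]

end QuadRep

theorem proposition2 :
    (∀ n : ℕ, 5 ≤ n → ∀ ε : ℝ, 0 < ε → ∃ c : ℝ, 0 < c ∧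
      ∀ (A : Matrix (Fin n) (Fin n) ℤ) (k : ℤ), A.IsSymm → A.det ≠ 0 →
        QuadRep.WeakLSC k A →
          QuadRep.SingularSeriesConverges k A ∧
          c * |(A.det : ℝ)| ^ (-QuadRep.theta k A - ε) ≤ QuadRep.singularSeries k A) ∧
    (∀ ε : ℝ, 0 < ε → ∃ c : ℝ, 0 < c ∧
      ∀ (A : Matrix (Fin 4) (Fin 4) ℤ) (k : ℤ), A.IsSymm → A.det ≠ 0 → 0 < k →
        QuadRep.StrongLSC k A →
          QuadRep.SingularSeriesConverges k A ∧
          c * ((k : ℝ) ^ (-ε) * |(A.det : ℝ)| ^ (-ε)) ≤ QuadRep.singularSeries k A) :=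
  ⟨fun _ hn _ hε => QuadRep.singularSeries_bound_of_five_le hn hε,
    fun _ hε => QuadRep.singularSeries_bound_of_four hε⟩
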